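/- For each $n$, let $Q=(Q_{ij})$ be a random symmetric $n\times n$ matrix whose entries $Q_{ij}$, $i\le j$, are independent, with $Q_{ii}\sim N(0,1)$ and $Q_{ij}\sim N(0,1/2)$ for $i<j$. Let $Z_{(1)}\le\dots\le Z_{(n)}$ be the ordered diagonal entries, let $\pi$ be the (almost surely unique) permutation with $Q_{\pi(r)\pi(r)}=Z_{(r)}$, and put $X_{ij}=Q_{\pi(i)\pi(j)}$ for $i<j$. Let $\Phi$ be the standard normal distribution function. For $1\le i<j\le n$ set $$\tau_{ij}=Z_{(1)}-\sqrt{(Z_{(i)}-Z_{(1)})(Z_{(j)}-Z_{(1)})},\qquad F_{ij}=\{X_{ij}<\tau_{ij}\},\qquad p_{ij}=\mathbb P(F_{ij}\mid Z_{(1)},\dots,Z_{(n)}),$$ and put $q_n=\Phi(\sqrt2\,Z_{(1)})$ and $$A_n=\mathbb E\Bigl[(1-q_n)^{n-1}\Bigl(1-\prod_{j=3}^n(1-p_{2j})\Bigr)\Bigr].$$ Then, as $n\to\infty$, $$A_n=\Bigl(3\sqrt{\tfrac{\pi}{2}}+o(1)\Bigr)\frac1{n\sqrt{\log n}}.$$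 More precisely, let $U_{(r)}=\Phi(Z_{(r)})$ and, for $0<u\le v<1$, let $$G(u,v)=\frac1{1-v}\int_v^1\Phi\Bigl(\sqrt2\Bigl[\Phi^{-1}(u)-\sqrt{(\Phi^{-1}(v)-\Phi^{-1}(u))(\Phi^{-1}(w)-\Phi^{-1}(u))}\Bigr]\Bigr)\,dw,$$ $I_n=(n-2)\,\mathbb E\,G(U_{(1)},U_{(2)})$ and $s=s_n(x)=-\Phi^{-1}(x/n)$ for $0<x<n$. Then: 1. $p_{ij}=\Phi(\sqrt2\,\tau_{ij})$ almost surely, for $1\le i<j\le n$. 2. $A_n=I_n+O\bigl(\frac{\log n}{n^2}\bigr)$ as $n\to\infty$. 3. For every $n\ge3$, $$n\sqrt{\log n}\;I_n=\int_0^n\int_0^{s^2(n/x-1)}R_n(x,\beta)\,d\beta\,dx,$$ where, with $v=x(1+\beta/s^2)/n$, $$R_n(x,\beta)=n\sqrt{\log n}\;\frac{(n-1)(n-2)}{n}\,(1-v)^{n-2}\,G\Bigl(\frac xn,v\Bigr)\frac{x}{s^2}.$$ 4. $R_n(x,\beta)\to\sqrt{\pi/2}\;x^3e^{-x}e^{-2\sqrt\beta}$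 as $n\to\infty$, uniformly on $[\delta,M]\times[0,B]$ for all $0<\delta<M<\infty$ and $0<B<\infty$. 5. $I_n=\bigl(3\sqrt{\pi/2}+o(1)\bigr)\frac{1}{n\sqrt{\log n}}$ as $n\to\infty$. -/

import Mathlib

open MeasureTheory ProbabilityTheory Filter Topology Asymptotics

noncomputable section

namespace GOE

/-- The standard normal distribution function `Φ`. -/
def Phi (x : ℝ) : ℝ := cdf (gaussianReal 0 1) x

/-- The standard normal quantile function `Φ⁻¹` (used at arguments in `(0,1)`). -/
def PhiInv (u : ℝ) : ℝ := sInf {x : ℝ | u ≤ Phi x}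

/-- `Q` is a random GOE matrix: symmetric, with independent upper-triangular entries,
diagonal entries `N(0,1)` and off-diagonal entries `N(0,1/2)`. -/
structure IsGOE {Ω : Type*} [MeasurableSpace Ω] {n : ℕ} (μ : Measure Ω)
    (Q : Ω → Matrix (Fin n) (Fin n) ℝ) : Prop where
  measurable : ∀ i j, Measurable fun ω => Q ω i j
  symm : ∀ ω, (Q ω).IsSymm
  diag : ∀ i, μ.map (fun ω => Q ω i i) = gaussianReal 0 1
  offDiag : ∀ i j, i < j → μ.map (fun ω => Q ω i j) = gaussianReal 0 (1 / 2)
  indep : iIndepFun (fun (e : {e : Fin n × Fin n // e.1 ≤ e.2}) ω => Q ω e.1.1 e.1.2) μ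

/-- The permutation `π` that sorts the diagonal of `M` increasingly. -/
def perm {n : ℕ} (M : Matrix (Fin n) (Fin n) ℝ) : Equiv.Perm (Fin n) :=
  Tuple.sort fun i => M i i

/-- The entry `M_{π(i) π(j)}`, for indices `1 ≤ i, j ≤ n` counted from one
(and `0` for indices that exceed `n`). -/
def reordered {n : ℕ} (M : Matrix (Fin n) (Fin n) ℝ) (i j : ℕ) : ℝ :=
  if h : i - 1 < n ∧ j - 1 < n then M (perm M ⟨i - 1, h.1⟩) (perm M ⟨j - 1, h.2⟩) else 0

/-- The `r`-th smallest diagonal entry `Z_(r)`, `1 ≤ r ≤ n`. -/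
def Z {n : ℕ} (M : Matrix (Fin n) (Fin n) ℝ) (r : ℕ) : ℝ := reordered M r r

/-- The off-diagonal entry `X_ij` after relabelling by the diagonal ordering. -/
def X {n : ℕ} (M : Matrix (Fin n) (Fin n) ℝ) (i j : ℕ) : ℝ := reordered M i j

/-- The two-coordinate threshold `τ_ij`. -/
def tau {n : ℕ} (M : Matrix (Fin n) (Fin n) ℝ) (i j : ℕ) : ℝ :=
  Z M 1 - √((Z M i - Z M 1) * (Z M j - Z M 1))

section Probability

variable {Ω : Type*} [MeasurableSpace Ω] {n : ℕ}

/-- The event `F_ij = {X_ij < τ_ij}`. -/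
def F (Q : Ω → Matrix (Fin n) (Fin n) ℝ) (i j : ℕ) : Set Ω :=
  {ω | X (Q ω) i j < tau (Q ω) i j}

/-- The σ-algebra generated by `Z_(1), …, Z_(n)`. -/
abbrev sigmaZ (Q : Ω → Matrix (Fin n) (Fin n) ℝ) : MeasurableSpace Ω :=
  MeasurableSpace.comap (fun ω (r : Fin n) => Z (Q ω) (r + 1)) inferInstance

/-- The conditional probability `p_ij = P(F_ij | Z_(1), …, Z_(n))`. -/
def p (μ : Measure Ω) (Q : Ω → Matrix (Fin n) (Fin n) ℝ) (i j : ℕ) : Ω → ℝ :=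
  μ[(F Q i j).indicator (fun _ => (1 : ℝ)) | sigmaZ Q]

/-- The random variable `q_n = Φ(√2 Z_(1))`. -/
def q (Q : Ω → Matrix (Fin n) (Fin n) ℝ) (ω : Ω) : ℝ := Phi (√2 * Z (Q ω) 1)

/-- The contribution `A_n` of the edges at the second-smallest diagonal entry. -/
def A (μ : Measure Ω) (Q : Ω → Matrix (Fin n) (Fin n) ℝ) : ℝ :=
  ∫ ω, (1 - q Q ω) ^ (n - 1) * (1 - ∏ j ∈ Finset.Icc 3 n, (1 - p μ Q 2 j ω)) ∂μ

/-- The variable `U_(r) = Φ(Z_(r))`. -/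
def U (Q : Ω → Matrix (Fin n) (Fin n) ℝ) (r : ℕ) (ω : Ω) : ℝ := Phi (Z (Q ω) r)

end Probability

/-- The pair probability `p(u,v,w)`, `0 < u ≤ v ≤ w < 1`. -/
def pairProb (u v w : ℝ) : ℝ :=
  Phi (√2 * (PhiInv u - √((PhiInv v - PhiInv u) * (PhiInv w - PhiInv u))))

/-- The averaged edge-probability function `G(u,v)`, `0 < u ≤ v < 1`. On the diagonal the formula
gives `G(u,u) = Φ(√2 Φ⁻¹(u))`, its continuous extension from `v > u`. -/
def G (u v : ℝ) : ℝ := 1 / (1 - v) * ∫ w in v..1, pairProb u v w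

/-- `I_n = (n-2) E G(U_(1), U_(2))`. -/
def I {Ω : Type*} [MeasurableSpace Ω] {n : ℕ} (μ : Measure Ω)
    (Q : Ω → Matrix (Fin n) (Fin n) ℝ) : ℝ :=
  ((n : ℝ) - 2) * ∫ ω, G (U Q 1 ω) (U Q 2 ω) ∂μ

/-- The quantile scale `s_n(x) = -Φ⁻¹(x/n)`. -/
def s (n : ℕ) (x : ℝ) : ℝ := -PhiInv (x / n)

/-- The integrand of `n √(log n) I_n` in the variables `(x, β)`, where `u = x/n`,
`v = x (1 + β/s²)/n` and `s = s_n(x)`; the factor `x/s²` is the Jacobian. -/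
def layerIntegrand (n : ℕ) (x β : ℝ) : ℝ :=
  (n * √(Real.log n)) * (((n : ℝ) - 1) * ((n : ℝ) - 2) / n) *
    (1 - x * (1 + β / s n x ^ 2) / n) ^ (n - 2) *
    G (x / n) (x * (1 + β / s n x ^ 2) / n) * (x / s n x ^ 2)

end GOE

end

namespace GOE

/-! The sorting permutation is a function of the diagonal alone, so given the diagonal each
relabelled off-diagonal entry is still `N(0,1/2)`; hence `p_ij = Φ(√2 τ_ij)` (`IsGOE.p_ae_eq`).
Since `τ_2j ≤ Z_(1)`, every `p_2j` is at most `q_n`, and the integrand of `A_n` differs from `∑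
p_2j` by at most `2 n² q_n²`. As `Φ(√2 Φ⁻¹(u))` is of order `u²` up to a logarithm and `U_(1)` is of
order `1/n`, `E q_n² = O(log n / n⁴)`, which gives the error `log n / n²` (`IsGOE.abs_A_sub_I_le`).
Given the two smallest values, the other uniforms are independent on `(U_(2), 1)`, so the expected
sum is `I_n` (`IsGOE.integral_sum_eq_I`), an integral against the density `n(n-1)(1-v)^(n-2)` on `0
< u < v < 1`.

Put `u = x/n`, `S = -Φ⁻¹(u)`, `v = u(1 + β/S²)` and `T = -Φ⁻¹(v)`. The Gaussian hazard rate near `S`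
is about `S`, so `S - T ≈ β/S³` (`tendsto_quantile_gap`). For fixed `w` the second gap `Φ⁻¹(w) + S`
is about `S`, so the square root in the threshold is about `√β/S`, and shifting the tail `Φ(-√2 S)`
by it costs the factor `exp(-2√β)` (`tendsto_Phi_shift_ratio`, `tendsto_G_ratio`). With `Φ(-√2 S) ~
√π S u²`, `log n ~ S²/2` and `(1-v)^(n-2) → exp(-x)`, the integrand tends to `√(π/2) x³ exp(-x)
exp(-2√β)` (`tendsto_layerIntegrand`). Finally `∫ exp(-2√β) dβ = 1/2` and `∫ x³ exp(-x) dx = 6` give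
the constant `3√(π/2)`.

Passing to the limit under the integrals is done by dominated convergence, in `β` and then in `x`.
The majorant comes from a nonasymptotic version of the same gap estimate (`G_le_exp`,
`layerIntegrand_le`) when `x² ≤ n`, and from `|G| ≤ 1` with exponential decay in `x` when `x² > n`.
-/

/-! ### The normal density, distribution function and quantile function. -/

/-- The standard normal density. -/
noncomputable def phi (x : ℝ) : ℝ := (√(2 * Real.pi))⁻¹ * Real.exp (-x ^ 2 / 2)

lemma phi_pos (x : ℝ) : 0 < phi x := by unfold phi; positivity

lemma phi_neg (x : ℝ) : phi (-x) = phi x := by simp [phi]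

lemma phi_eq_gaussianPDFReal (x : ℝ) : phi x = gaussianPDFReal 0 1 x := by
  simp [phi, gaussianPDFReal]

lemma continuous_phi : Continuous phi := by unfold phi; fun_prop

lemma hasDerivAt_phi (x : ℝ) : HasDerivAt phi (-x * phi x) x := by
  have h : HasDerivAt (fun x : ℝ => -x ^ 2 / 2) (-x) x := by
    have := ((hasDerivAt_pow 2 x).neg).div_const 2
    refine this.congr_deriv ?_
    norm_num
    ring
  refine (h.exp.const_mul (√(2 * Real.pi))⁻¹).congr_deriv ?_
  unfold phi; ring

lemma phi_add (r b : ℝ) : phi (r + b) = Real.exp (-r * b - b ^ 2 / 2) * phi r := by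
  unfold phi
  rw [mul_left_comm, ← Real.exp_add]
  congr 2; ring

lemma Phi_eq_integral (x : ℝ) : Phi x = ∫ y in Set.Iic x, phi y := by
  unfold Phi
  rw [cdf_eq_real, measureReal_def, gaussianReal_apply_eq_integral 0 one_ne_zero,
    ENNReal.toReal_ofReal (setIntegral_nonneg measurableSet_Iic
      fun y _ => gaussianPDFReal_nonneg 0 1 y)]
  simp only [phi_eq_gaussianPDFReal]

lemma integrable_phi : Integrable phi := by
  have := integrable_gaussianPDFReal 0 1
  rwa [show phi = gaussianPDFReal 0 1 from funext phi_eq_gaussianPDFReal]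

lemma hasDerivAt_Phi (x : ℝ) : HasDerivAt Phi (phi x) x := by
  have h : Phi = fun x => (∫ y in Set.Iic 0, phi y) + ∫ y in (0 : ℝ)..x, phi y := by
    funext x
    rw [Phi_eq_integral, ← intervalIntegral.integral_Iic_sub_Iic
      integrable_phi.integrableOn integrable_phi.integrableOn]
    ring
  rw [h]
  exact (intervalIntegral.integral_hasDerivAt_right (integrable_phi.intervalIntegrable)
    (continuous_phi.stronglyMeasurableAtFilter _ _) continuous_phi.continuousAt).const_add _

lemma continuous_Phi : Continuous Phi :=
  continuous_iff_continuousAt.2 fun x => (hasDerivAt_Phi x).continuousAt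

lemma strictMono_Phi : StrictMono Phi :=
  strictMono_of_hasDerivAt_pos hasDerivAt_Phi phi_pos

lemma tendsto_Phi_atBot : Tendsto Phi atBot (𝓝 0) := tendsto_cdf_atBot _

lemma tendsto_Phi_atTop : Tendsto Phi atTop (𝓝 1) := tendsto_cdf_atTop _

lemma Phi_pos (x : ℝ) : 0 < Phi x :=
  (cdf_nonneg _ (x - 1)).trans_lt (strictMono_Phi (by linarith : x - 1 < x))

lemma Phi_lt_one (x : ℝ) : Phi x < 1 :=
  (strictMono_Phi (by linarith : x < x + 1)).trans_le (cdf_le_one _ (x + 1))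

lemma Phi_mem_Ioo (x : ℝ) : Phi x ∈ Set.Ioo (0 : ℝ) 1 := ⟨Phi_pos x, Phi_lt_one x⟩

lemma range_Phi : Set.range Phi = Set.Ioo 0 1 := by
  apply Set.Subset.antisymm
  · rintro _ ⟨x, rfl⟩; exact Phi_mem_Ioo x
  · intro u hu
    exact mem_range_of_exists_le_of_exists_ge continuous_Phi
      ((tendsto_Phi_atBot.eventually (ge_mem_nhds hu.1)).exists)
      ((tendsto_Phi_atTop.eventually (le_mem_nhds hu.2)).exists)

lemma measurableEmbedding_Phi : MeasurableEmbedding Phi :=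
  continuous_Phi.measurableEmbedding strictMono_Phi.injective

lemma PhiInv_Phi (x : ℝ) : PhiInv (Phi x) = x := by
  have : {y : ℝ | Phi x ≤ Phi y} = Set.Ici x := by
    ext y; simp [strictMono_Phi.le_iff_le]
  rw [PhiInv, this, csInf_Ici]

lemma Phi_PhiInv {u : ℝ} (hu : u ∈ Set.Ioo (0 : ℝ) 1) : Phi (PhiInv u) = u := by
  rw [← range_Phi] at hu
  obtain ⟨x, rfl⟩ := hu
  rw [PhiInv_Phi]

lemma PhiInv_le_PhiInv {u v : ℝ} (hu : 0 < u) (hv : v < 1) (huv : u ≤ v) :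
    PhiInv u ≤ PhiInv v := by
  rw [← strictMono_Phi.le_iff_le, Phi_PhiInv ⟨hu, huv.trans_lt hv⟩,
    Phi_PhiInv ⟨hu.trans_le huv, hv⟩]
  exact huv

/-- The infimum runs over the empty set or over all reals, and `sInf` returns `0` in both cases.
This serves only to make `PhiInv` measurable on the whole line. -/
lemma PhiInv_of_notMem {u : ℝ} (hu : u ∉ Set.Ioo (0 : ℝ) 1) : PhiInv u = 0 := by
  by_cases h : 0 < u
  · have : {y : ℝ | u ≤ Phi y} = ∅ := by
      ext y
      simp only [Set.mem_ofPred_eq, Set.mem_empty_iff_false, iff_false, not_le]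
      exact (Phi_lt_one y).trans_le (not_lt.1 fun h1 => hu ⟨h, h1⟩)
    rw [PhiInv, this, Real.sInf_empty]
  · have : {y : ℝ | u ≤ Phi y} = Set.univ := by
      ext y
      simpa using (not_lt.1 h).trans (Phi_pos y).le
    rw [PhiInv, this, Real.sInf_univ]

lemma measurable_PhiInv : Measurable PhiInv := by
  refine measurable_of_Iic fun a => ?_
  have : PhiInv ⁻¹' Set.Iic a =
      (Set.Ioo 0 1 ∩ Set.Iic (Phi a)) ∪ ((Set.Ioo 0 1)ᶜ ∩ {_u | 0 ≤ a}) := by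
    ext u
    by_cases hu : u ∈ Set.Ioo (0 : ℝ) 1
    · have : PhiInv u ≤ a ↔ u ≤ Phi a := by
        rw [← strictMono_Phi.le_iff_le, Phi_PhiInv hu]
      simp [this, hu, -Set.mem_Ioo]
    · simp [PhiInv_of_notMem hu, hu, -Set.mem_Ioo]
  rw [this]
  exact (measurableSet_Ioo.inter measurableSet_Iic).union
    (measurableSet_Ioo.compl.inter (MeasurableSet.const _))

/-! ### Gaussian tails: Mills bounds, hazard rate and tail asymptotics. -/

/-- The engine for the three tail inequalities below: the difference of the two sides is
nonincreasing and vanishes at infinity. -/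
lemma nonneg_of_antitone_of_tendsto {f f' : ℝ → ℝ} {a : ℝ}
    (hf : ∀ r > a, HasDerivAt f (f' r) r) (hf' : ∀ r > a, f' r ≤ 0)
    (hlim : Tendsto f atTop (𝓝 0)) {r : ℝ} (hr : a < r) : 0 ≤ f r := by
  have hanti : AntitoneOn f (Set.Ici r) := by
    refine antitoneOn_of_deriv_nonpos (convex_Ici r)
      (fun x hx => (hf x (hr.trans_le hx)).continuousAt.continuousWithinAt)
      (fun x hx => ?_) (fun x hx => ?_)
    · rw [interior_Ici] at hx
      exact (hf x (hr.trans hx)).differentiableAt.differentiableWithinAt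
    · rw [interior_Ici] at hx
      rw [(hf x (hr.trans hx)).deriv]
      exact hf' x (hr.trans hx)
  refine le_of_tendsto hlim ?_
  filter_upwards [eventually_ge_atTop r] with y hy
  exact hanti Set.self_mem_Ici hy hy

lemma tendsto_Phi_neg_atTop : Tendsto (fun r => Phi (-r)) atTop (𝓝 0) :=
  tendsto_Phi_atBot.comp tendsto_neg_atTop_atBot

lemma tendsto_phi_atTop : Tendsto phi atTop (𝓝 0) := by
  have h : Tendsto (fun x : ℝ => -x ^ 2 / 2) atTop atBot := by
    have := (tendsto_pow_atTop (α := ℝ) two_ne_zero).atTop_div_const (r := 2) (by norm_num)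
    refine (tendsto_neg_atTop_atBot.comp this).congr fun x => ?_
    simp [neg_div]
  have := (Real.tendsto_exp_atBot.comp h).const_mul (√(2 * Real.pi))⁻¹
  rwa [mul_zero] at this

lemma hasDerivAt_Phi_neg (r : ℝ) : HasDerivAt (fun r => Phi (-r)) (-phi r) r := by
  have := (hasDerivAt_Phi (-r)).comp r (hasDerivAt_neg r)
  refine this.congr_deriv ?_
  rw [phi_neg]; ring

/-- In the derivative in `r` of the difference, the density terms cancel by `phi_add`, leaving `-b`
times the right-hand side. No sign of `r` is needed. -/
lemma Phi_neg_add_le (r : ℝ) {b : ℝ} (hb : 0 ≤ b) :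
    Phi (-(r + b)) ≤ Real.exp (-r * b - b ^ 2 / 2) * Phi (-r) := by
  have hexp : ∀ r : ℝ, HasDerivAt (fun r : ℝ => Real.exp (-r * b - b ^ 2 / 2))
      (Real.exp (-r * b - b ^ 2 / 2) * (-b)) r := fun r => by
    have h : HasDerivAt (fun r : ℝ => -r * b - b ^ 2 / 2) (-b) r := by
      refine (((hasDerivAt_neg r).mul_const b).sub_const _).congr_deriv ?_
      ring
    exact h.exp
  have hlim : Tendsto (fun r : ℝ => Real.exp (-r * b - b ^ 2 / 2) * Phi (-r) - Phi (-(r + b)))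
      atTop (𝓝 0) := by
    have h2 : Tendsto (fun r : ℝ => Phi (-(r + b))) atTop (𝓝 0) :=
      tendsto_Phi_neg_atTop.comp (tendsto_atTop_add_const_right _ _ tendsto_id)
    have h1 : Tendsto (fun r : ℝ => Real.exp (-r * b - b ^ 2 / 2) * Phi (-r)) atTop (𝓝 0) := by
      refine squeeze_zero' (Eventually.of_forall fun r => by have := Phi_pos (-r); positivity) ?_
        tendsto_Phi_neg_atTop
      filter_upwards [eventually_ge_atTop 0] with r hr
      refine mul_le_of_le_one_left (Phi_pos _).le (Real.exp_le_one_iff.2 ?_)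
      nlinarith [mul_nonneg hr hb, sq_nonneg b]
    simpa using h1.sub h2
  have := nonneg_of_antitone_of_tendsto (a := r - 1) (r := r)
    (f := fun r : ℝ => Real.exp (-r * b - b ^ 2 / 2) * Phi (-r) - Phi (-(r + b)))
    (f' := fun r => -b * (Real.exp (-r * b - b ^ 2 / 2) * Phi (-r))) (fun r _ => ?_) (fun r _ => ?_)
    hlim (by linarith)
  · linarith
  · have h3 : HasDerivAt (fun r => Phi (-(r + b))) (-phi (r + b)) r := by
      refine ((hasDerivAt_Phi_neg (r + b)).comp r ((hasDerivAt_id r).add_const b)).congr_deriv ?_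
      rw [mul_one]
    refine (((hexp r).mul (hasDerivAt_Phi_neg r)).sub h3).congr_deriv ?_
    rw [phi_add]; ring
  · have := Phi_pos (-r)
    have : 0 ≤ Real.exp (-r * b - b ^ 2 / 2) * Phi (-r) := by positivity
    nlinarith

lemma Phi_neg_le_exp {b : ℝ} (hb : 0 ≤ b) : Phi (-b) ≤ Real.exp (-b ^ 2 / 2) := by
  have := Phi_neg_add_le 0 hb
  simp only [zero_add, neg_zero, zero_mul, zero_sub] at this
  refine this.trans ?_
  rw [neg_div]
  exact mul_le_of_le_one_right (Real.exp_pos _).le (Phi_lt_one 0).le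

/-- The upper Mills bound. -/
lemma Phi_neg_le_phi_div {r : ℝ} (hr : 0 < r) : Phi (-r) ≤ phi r / r := by
  have hlim : Tendsto (fun r : ℝ => phi r / r - Phi (-r)) atTop (𝓝 0) := by
    have := (tendsto_phi_atTop.div_atTop tendsto_id).sub tendsto_Phi_neg_atTop
    simpa using this
  have := nonneg_of_antitone_of_tendsto (a := 0) (r := r) (f := fun r : ℝ => phi r / r - Phi (-r))
    (f' := fun r => -(phi r / r ^ 2)) (fun r hr => ?_) (fun r _ => ?_) hlim hr
  · linarith
  · have hr' : r ≠ 0 := ne_of_gt hr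
    refine (((hasDerivAt_phi r).div (hasDerivAt_id r) hr').sub (hasDerivAt_Phi_neg r)).congr_deriv ?_
    simp only [id]
    field_simp
    ring
  · have := phi_pos r
    have : 0 ≤ phi r / r ^ 2 := by positivity
    linarith

/-- The lower Mills bound. -/
lemma phi_mul_div_le_Phi_neg (r : ℝ) : phi r * (r / (1 + r ^ 2)) ≤ Phi (-r) := by
  have hlim : Tendsto (fun r : ℝ => Phi (-r) - phi r * (r / (1 + r ^ 2))) atTop (𝓝 0) := by
    have h1 : Tendsto (fun r : ℝ => phi r * (r / (1 + r ^ 2))) atTop (𝓝 0) := by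
      refine squeeze_zero' ?_ ?_ tendsto_phi_atTop
      · filter_upwards [eventually_ge_atTop 0] with r hr
        have := phi_pos r
        positivity
      · filter_upwards with r
        refine mul_le_of_le_one_right (phi_pos r).le ?_
        rw [div_le_one (by positivity)]
        nlinarith [sq_nonneg (r - 1)]
    simpa using tendsto_Phi_neg_atTop.sub h1
  have := nonneg_of_antitone_of_tendsto (a := r - 1) (r := r)
    (f := fun r : ℝ => Phi (-r) - phi r * (r / (1 + r ^ 2)))
    (f' := fun r => -(2 * phi r / (1 + r ^ 2) ^ 2)) (fun r hr => ?_) (fun r _ => ?_) hlim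
    (by linarith)
  · linarith
  · have h0 : (1 + r ^ 2) ≠ 0 := by positivity
    have hd : HasDerivAt (fun r : ℝ => 1 + r ^ 2) (2 * r) r := by
      simpa using (hasDerivAt_pow 2 r).const_add 1
    refine ((hasDerivAt_Phi_neg r).sub
      ((hasDerivAt_phi r).mul ((hasDerivAt_id r).div hd h0))).congr_deriv ?_
    simp only [id, Pi.div_apply]
    field_simp
    ring
  · have := phi_pos r
    have : 0 ≤ 2 * phi r / (1 + r ^ 2) ^ 2 := by positivity
    linarith

lemma phi_div_le_Phi_neg {r : ℝ} (hr : 1 ≤ r) : phi r / (2 * r) ≤ Phi (-r) := by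
  refine le_trans ?_ (phi_mul_div_le_Phi_neg r)
  rw [div_eq_mul_one_div]
  refine mul_le_mul_of_nonneg_left ?_ (phi_pos r).le
  rw [div_le_div_iff₀ (by positivity) (by positivity)]
  nlinarith

/-- The logarithmic derivative of the tail is minus the hazard rate `phi / Phi(-·)`, which the Mills
bounds trap between `r` and `r + 1/r`. This converts a ratio of tail probabilities into a distance
between quantiles. -/
lemma exists_hazard_slope {t s : ℝ} (hts : t < s) :
    ∃ ξ ∈ Set.Ioo t s, Real.log (Phi (-t)) - Real.log (Phi (-s)) =
      phi ξ / Phi (-ξ) * (s - t) := by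
  have hd : ∀ r, HasDerivAt (fun r => Real.log (Phi (-r))) (-phi r / Phi (-r)) r := fun r =>
    (hasDerivAt_Phi_neg r).log (Phi_pos _).ne'
  obtain ⟨ξ, hξ, h⟩ := exists_hasDerivAt_eq_slope (fun r => Real.log (Phi (-r))) _ hts
    (fun r _ => (hd r).continuousAt.continuousWithinAt) (fun r _ => hd r)
  refine ⟨ξ, hξ, ?_⟩
  rw [eq_div_iff (by linarith)] at h
  rw [neg_div] at h
  linarith

lemma le_hazard {r : ℝ} (hr : 0 < r) : r ≤ phi r / Phi (-r) := by
  rw [le_div_iff₀ (Phi_pos _), mul_comm, ← le_div_iff₀ hr]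
  exact Phi_neg_le_phi_div hr

lemma hazard_le {r : ℝ} (hr : 0 < r) : phi r / Phi (-r) ≤ r + 1 / r := by
  rw [div_le_iff₀ (Phi_pos _)]
  have h := mul_le_mul_of_nonneg_left (phi_mul_div_le_Phi_neg r)
    (by positivity : 0 ≤ r + 1 / r)
  refine le_trans (le_of_eq ?_) h
  field_simp
  ring

lemma mul_sub_le_log_sub {t s : ℝ} (ht : 0 < t) (hts : t ≤ s) :
    t * (s - t) ≤ Real.log (Phi (-t)) - Real.log (Phi (-s)) := by
  rcases hts.eq_or_lt with rfl | hts
  · simp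
  obtain ⟨ξ, hξ, h⟩ := exists_hazard_slope hts
  rw [h]
  exact mul_le_mul_of_nonneg_right (hξ.1.le.trans (le_hazard (ht.trans hξ.1))) (by linarith)

lemma log_sub_le_mul_sub {t s : ℝ} (ht : 0 < t) (hts : t ≤ s) :
    Real.log (Phi (-t)) - Real.log (Phi (-s)) ≤ (s + 1 / t) * (s - t) := by
  rcases hts.eq_or_lt with rfl | hts
  · simp
  obtain ⟨ξ, hξ, h⟩ := exists_hazard_slope hts
  rw [h]
  refine mul_le_mul_of_nonneg_right ((hazard_le (ht.trans hξ.1)).trans ?_) (by linarith)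
  have : 1 / ξ ≤ 1 / t := one_div_le_one_div_of_le ht hξ.1.le
  linarith [hξ.2]

lemma tendsto_PhiInv_zero : Tendsto PhiInv (𝓝[>] 0) atBot := by
  rw [tendsto_atBot]
  intro b
  have : Set.Ioo 0 (Phi b) ∈ 𝓝[>] (0 : ℝ) := Ioo_mem_nhdsGT (Phi_pos b)
  filter_upwards [this] with u hu
  rw [← strictMono_Phi.le_iff_le, Phi_PhiInv ⟨hu.1, hu.2.trans (Phi_lt_one b)⟩]
  exact hu.2.le

lemma tendsto_mul_Phi_neg_div_phi : Tendsto (fun s => s * Phi (-s) / phi s) atTop (𝓝 1) := by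
  have h1 : Tendsto (fun s : ℝ => 1 - 1 / (1 + s ^ 2)) atTop (𝓝 1) := by
    have : Tendsto (fun s : ℝ => 1 + s ^ 2) atTop atTop :=
      tendsto_atTop_add_const_left _ _ (tendsto_pow_atTop two_ne_zero)
    simpa using (this.const_div_atTop 1).const_sub 1
  refine tendsto_of_tendsto_of_tendsto_of_le_of_le' h1 tendsto_const_nhds ?_ ?_
  · filter_upwards [eventually_gt_atTop 0] with s hs
    rw [le_div_iff₀ (phi_pos s)]
    refine le_trans (le_of_eq ?_) (mul_le_mul_of_nonneg_left (phi_mul_div_le_Phi_neg s) hs.le)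
    field_simp
    ring
  · filter_upwards [eventually_gt_atTop 0] with s hs
    rw [div_le_one (phi_pos s), mul_comm, ← le_div_iff₀ hs]
    exact Phi_neg_le_phi_div hs

lemma phi_sqrt_two_mul (s : ℝ) : phi (√2 * s) = √(2 * Real.pi) * phi s ^ 2 := by
  have h : √(2 * Real.pi) ≠ 0 := by positivity
  unfold phi
  rw [mul_pow, mul_pow, ← Real.exp_nat_mul, Real.sq_sqrt zero_le_two]
  rw [show ((2 : ℕ) : ℝ) * (-s ^ 2 / 2) = -(2 * s ^ 2) / 2 by push_cast; ring]
  field_simp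

/-- Mills asymptotics at `√2 s` and at `s`, linked by `phi_sqrt_two_mul`; the constant is
`√(2π)/√2`. -/
lemma tendsto_Phi_sqrt_two_ratio :
    Tendsto (fun s => Phi (-(√2 * s)) / (Phi (-s) ^ 2 * s)) atTop (𝓝 √Real.pi) := by
  have h2 : Tendsto (fun s : ℝ => √2 * s) atTop atTop :=
    tendsto_id.const_mul_atTop (by positivity)
  have h := (tendsto_mul_Phi_neg_div_phi.comp h2).div (tendsto_mul_Phi_neg_div_phi.pow 2)
    (by norm_num)
  have h' := h.mul_const √Real.pi
  simp only [Function.comp_def, one_pow, div_one, one_mul] at h'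
  refine h'.congr' ?_
  filter_upwards [eventually_gt_atTop 0] with s hs
  simp only [Pi.div_apply]
  have := phi_pos s
  have h3 := Phi_pos (-s)
  rw [phi_sqrt_two_mul, Real.sqrt_mul zero_le_two]
  have h4 : √Real.pi ≠ 0 := by positivity
  field_simp

/-- Nonasymptotic counterpart of the preceding limit: `8 = 2 · 2²` comes from `√π ≤ 2` and `phi s ≤
2 s Phi(-s)`. -/
lemma Phi_sqrt_two_le {s : ℝ} (hs : 1 ≤ s) : Phi (-(√2 * s)) ≤ 8 * s * Phi (-s) ^ 2 := by
  have h2 : 0 < √2 := by positivity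
  have hs0 : 0 < s := by linarith
  have h := Phi_neg_le_phi_div (mul_pos h2 hs0)
  rw [phi_sqrt_two_mul, Real.sqrt_mul zero_le_two] at h
  have h3 : phi s ≤ 2 * s * Phi (-s) := by
    have := phi_div_le_Phi_neg hs
    rwa [div_le_iff₀ (by positivity), mul_comm] at this
  have h4 : √Real.pi ≤ 2 := by
    rw [Real.sqrt_le_left zero_le_two]; linarith [Real.pi_lt_four]
  have h5 : phi s ^ 2 ≤ (2 * s * Phi (-s)) ^ 2 := by
    gcongr
    exact (phi_pos s).le
  calc _ ≤ _ := h
    _ = √Real.pi * phi s ^ 2 / s := by field_simp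
    _ ≤ 2 * (2 * s * Phi (-s)) ^ 2 / s := by gcongr
    _ = _ := by field_simp; ring

lemma log_inv_Phi_neg_le {s : ℝ} (hs : 1 ≤ s) : Real.log (1 / Phi (-s)) ≤ 8 * s ^ 2 := by
  have h := phi_div_le_Phi_neg hs
  have h1 : Real.exp (-(8 * s ^ 2)) ≤ phi s / (2 * s) := by
    unfold phi
    have hp : √(2 * Real.pi) ≤ 3 := by
      rw [Real.sqrt_le_left (by norm_num)]; linarith [Real.pi_lt_four]
    -- The factor `2s√(2π) ≤ 6s` is absorbed by `exp(6s²)`; what remains, `exp(-2s²)`, is below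
    -- `exp(-s²/2)`.
    have : (6 * s) ≤ Real.exp (6 * s ^ 2) := by
      nlinarith [Real.add_one_le_exp (6 * s ^ 2)]
    rw [le_div_iff₀ (by positivity), ← div_eq_inv_mul, le_div_iff₀ (by positivity)]
    calc Real.exp (-(8 * s ^ 2)) * (2 * s) * √(2 * Real.pi)
        ≤ Real.exp (-(8 * s ^ 2)) * (2 * s) * 3 := by gcongr
      _ = Real.exp (-(8 * s ^ 2)) * (6 * s) := by ring
      _ ≤ Real.exp (-(8 * s ^ 2)) * Real.exp (6 * s ^ 2) := by gcongr
      _ = Real.exp (-2 * s ^ 2) := by rw [← Real.exp_add]; ring_nf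
      _ ≤ _ := by
        apply Real.exp_le_exp.2; nlinarith [sq_nonneg s]
  have h2 := Real.log_le_log (Real.exp_pos _) (h1.trans h)
  rw [Real.log_exp] at h2
  rw [one_div, Real.log_inv]
  linarith

/-- Logarithm of the Mills asymptotics, where only the Gaussian exponent survives division by `s²`.
With `Phi(-s) = x/n` it says `log n ~ s²/2`. -/
lemma tendsto_log_inv_Phi_neg_div_sq :
    Tendsto (fun s => Real.log (1 / Phi (-s)) / s ^ 2) atTop (𝓝 (1 / 2)) := by
  have h0 : Tendsto (fun s : ℝ => (s ^ 2)⁻¹) atTop (𝓝 0) :=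
    (tendsto_pow_atTop two_ne_zero).inv_tendsto_atTop
  have h1 : Tendsto (fun s => Real.log (s * Phi (-s) / phi s) * (s ^ 2)⁻¹) atTop (𝓝 0) := by
    have := (tendsto_mul_Phi_neg_div_phi.log one_ne_zero).mul h0
    simpa using this
  have h2 : Tendsto (fun s : ℝ => Real.log s * (s ^ 2)⁻¹) atTop (𝓝 0) := by
    have := (isLittleO_log_rpow_atTop (r := 2) (by norm_num)).tendsto_div_nhds_zero
    simpa [div_eq_mul_inv] using this
  have h3 := ((h0.const_mul (Real.log √(2 * Real.pi))).add h2).sub h1 |>.const_add (1 / 2)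
  simp only [mul_zero, add_zero, sub_zero] at h3
  refine h3.congr' ?_
  filter_upwards [eventually_gt_atTop 0] with s hs
  have hp := phi_pos s
  have hP := Phi_pos (-s)
  rw [one_div (Phi (-s)), Real.log_inv, Real.log_div (by positivity) hp.ne',
    Real.log_mul hs.ne' hP.ne', phi,
    Real.log_mul (by positivity) (by positivity), Real.log_inv, Real.log_exp]
  field_simp
  ring

/-! ### Order statistics and the conditional pair probabilities. -/

lemma gaussianReal_real_Iio (t : ℝ) :
    (gaussianReal 0 1).real (Set.Iio t) = Phi t := by
  have := nullSingletonClass_gaussianReal (μ := 0) one_ne_zero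
  rw [Phi, cdf_eq_real]
  exact measureReal_congr Iio_ae_eq_Iic

lemma gaussianReal_real_Ioi (t : ℝ) :
    (gaussianReal 0 1).real (Set.Ioi t) = 1 - Phi t := by
  rw [Phi, cdf_eq_real, ← Set.compl_Iic, probReal_compl_eq_one_sub measurableSet_Iic]

lemma gaussianReal_half_real_Iio (t : ℝ) :
    (gaussianReal 0 (1 / 2)).real (Set.Iio t) = Phi (√2 * t) := by
  have h2 : 0 < √2 := by positivity
  have hmap : (gaussianReal 0 (1 / 2)).map (√2 * ·) = gaussianReal 0 1 := by
    rw [gaussianReal_map_const_mul]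
    congr 1
    · simp
    · ext; simp
  rw [← gaussianReal_real_Iio, ← hmap, map_measureReal_apply (by fun_prop) measurableSet_Iio]
  congr 1
  ext y
  simp [h2]

/-- By independence the joint law is a product, so Fubini integrates `Y` out with `D` frozen. It is
applied with `D` the whole diagonal and `Y` one off-diagonal entry. -/
lemma setIntegral_indicator_lt_eq {Ω E : Type*} [MeasurableSpace Ω] [MeasurableSpace E]
    {μ : Measure Ω} [IsProbabilityMeasure μ] {D : Ω → E} {Y : Ω → ℝ} (hD : Measurable D)
    (hY : Measurable Y) (hind : IndepFun D Y μ) (hlaw : μ.map Y = gaussianReal 0 (1 / 2))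
    {t : E → ℝ} (ht : Measurable t) {S : Set E} (hS : MeasurableSet S) :
    ∫ ω in D ⁻¹' S, {ω | Y ω < t (D ω)}.indicator (fun _ => (1 : ℝ)) ω ∂μ =
      ∫ ω in D ⁻¹' S, Phi (√2 * t (D ω)) ∂μ := by
  have hmeas : MeasurableSet {z : E × ℝ | z.1 ∈ S ∧ z.2 < t z.1} :=
    (measurable_fst hS).inter (measurableSet_lt measurable_snd (ht.comp measurable_fst))
  have : IsProbabilityMeasure (μ.map D) := Measure.isProbabilityMeasure_map hD.aemeasurable
  have h1 : ∫ ω in D ⁻¹' S, {ω | Y ω < t (D ω)}.indicator (fun _ => (1 : ℝ)) ω ∂μ =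
      ∫ z, {z : E × ℝ | z.1 ∈ S ∧ z.2 < t z.1}.indicator (fun _ => (1 : ℝ)) z
        ∂((μ.map D).prod (gaussianReal 0 (1 / 2))) := by
    rw [← hlaw, ← (indepFun_iff_map_prod_eq_prod_map_map hD.aemeasurable hY.aemeasurable).1 hind,
      integral_map (hD.prodMk hY).aemeasurable
        (measurable_const.indicator hmeas).aestronglyMeasurable, ← integral_indicator (hD hS)]
    refine integral_congr_ae (Eventually.of_forall fun ω => ?_)
    by_cases h : D ω ∈ S <;> by_cases h' : Y ω < t (D ω) <;> simp [Set.indicator, h, h']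
  rw [h1, integral_prod _ ((integrable_const (1 : ℝ)).indicator hmeas), ← integral_indicator (hD hS)]
  have h2 := integral_map (μ := μ) (φ := D) (f := S.indicator fun d => Phi (√2 * t d))
    hD.aemeasurable
    (((continuous_Phi.measurable.comp (ht.const_mul _)).indicator hS).aestronglyMeasurable)
  refine Eq.trans ?_ h2
  refine integral_congr_ae (Eventually.of_forall fun d => ?_)
  by_cases h : d ∈ S
  · have : ∀ y, {z : E × ℝ | z.1 ∈ S ∧ z.2 < t z.1}.indicator (fun _ => (1 : ℝ)) (d, y) =
        (Set.Iio (t d)).indicator 1 y := fun y => by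
      simp [Set.indicator, h]
    simp only [this]
    rw [integral_indicator_one measurableSet_Iio, gaussianReal_half_real_Iio]
    simp [h]
  · simp [Set.indicator, h]

section OrderStat

variable {n : ℕ}

/-- `Tuple.sort` breaks ties by index, so the event is cut out by finitely many comparisons of
coordinates: weak order along `σ`, plus increasing indices on ties. -/
lemma measurableSet_sort_eq (σ : Equiv.Perm (Fin n)) :
    MeasurableSet {x : Fin n → ℝ | Tuple.sort x = σ} := by
  have : {x : Fin n → ℝ | Tuple.sort x = σ} =
      (⋂ i, ⋂ j, {x | i ≤ j → x (σ i) ≤ x (σ j)}) ∩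
        ⋂ i, ⋂ j, {x | i < j → x (σ i) = x (σ j) → σ i < σ j} := by
    ext x
    simp only [Set.mem_ofPred_eq, Set.mem_inter_iff, Set.mem_iInter]
    rw [eq_comm, Tuple.eq_sort_iff]
    rfl
  rw [this]
  refine (MeasurableSet.iInter fun i => MeasurableSet.iInter fun j => ?_).inter
    (MeasurableSet.iInter fun i => MeasurableSet.iInter fun j => ?_)
  · by_cases h : i ≤ j
    · simpa [h] using measurableSet_le (measurable_pi_apply (σ i)) (measurable_pi_apply (σ j))
    · simp [h]
  · by_cases h : i < j
    · by_cases h' : σ i < σ j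
      · simp [h']
      · convert (measurableSet_eq_fun (f := fun x : Fin n → ℝ => x (σ i)) (g := fun x => x (σ j))
            (measurable_pi_apply (σ i)) (measurable_pi_apply (σ j))).compl using 1
        ext x
        simp [h, h']
    · simp [h]

lemma measurable_sort_apply {Ω β : Type*} [MeasurableSpace Ω] [MeasurableSpace β]
    {x : Ω → Fin n → ℝ} (hx : Measurable x) {g : Equiv.Perm (Fin n) → Ω → β}
    (hg : ∀ σ, Measurable (g σ)) : Measurable fun ω => g (Tuple.sort (x ω)) ω := by
  intro s hs
  have : (fun ω => g (Tuple.sort (x ω)) ω) ⁻¹' s =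
      ⋃ σ, x ⁻¹' {x | Tuple.sort x = σ} ∩ g σ ⁻¹' s := by
    ext ω; simp
  rw [this]
  exact MeasurableSet.iUnion fun σ => (hx (measurableSet_sort_eq σ)).inter (hg σ hs)

/-- The `r`-th smallest coordinate of a vector, counted from one. -/
noncomputable def orderStat (x : Fin n → ℝ) (r : ℕ) : ℝ :=
  if h : r - 1 < n then x (Tuple.sort x ⟨r - 1, h⟩) else 0

lemma Z_eq_orderStat (M : Matrix (Fin n) (Fin n) ℝ) (r : ℕ) :
    Z M r = orderStat (fun i => M i i) r := by
  unfold Z reordered orderStat perm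
  by_cases h : r - 1 < n <;> simp [h]

lemma measurable_orderStat (r : ℕ) : Measurable fun x : Fin n → ℝ => orderStat x r := by
  unfold orderStat
  by_cases h : r - 1 < n
  · simp only [h, dif_pos]
    exact measurable_sort_apply (g := fun σ x => x (σ ⟨r - 1, h⟩)) measurable_id
      fun σ => measurable_pi_apply _
  · simp [h]

/-- The threshold `τ_ij` as a function of the diagonal. -/
noncomputable def diagTau (x : Fin n → ℝ) (i j : ℕ) : ℝ :=
  orderStat x 1 - √((orderStat x i - orderStat x 1) * (orderStat x j - orderStat x 1))

lemma tau_eq_diagTau (M : Matrix (Fin n) (Fin n) ℝ) (i j : ℕ) :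
    tau M i j = diagTau (fun k => M k k) i j := by
  simp only [tau, diagTau, Z_eq_orderStat]

lemma measurable_diagTau (i j : ℕ) : Measurable fun x : Fin n → ℝ => diagTau x i j := by
  unfold diagTau
  have := fun r => measurable_orderStat (n := n) r
  fun_prop

end OrderStat

lemma measurable_sigmaZ_Z {Ω : Type*} {n : ℕ} {Q : Ω → Matrix (Fin n) (Fin n) ℝ} {r : ℕ}
    (h1 : 1 ≤ r) (hr : r ≤ n) :
    Measurable[sigmaZ Q] fun ω => Z (Q ω) r := by
  have h : Measurable[sigmaZ Q] fun ω (r : Fin n) => Z (Q ω) (r + 1) := comap_measurable _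
  have := (measurable_pi_apply (⟨r - 1, by omega⟩ : Fin n)).comp h
  simpa [Function.comp_def, Nat.sub_add_cancel h1] using this

lemma measurable_sigmaZ_tau {Ω : Type*} {n : ℕ} {Q : Ω → Matrix (Fin n) (Fin n) ℝ} {i j : ℕ}
    (hi : 1 ≤ i) (hij : i < j) (hj : j ≤ n) :
    Measurable[sigmaZ Q] fun ω => tau (Q ω) i j := by
  have h1 := measurable_sigmaZ_Z (Q := Q) (r := 1) le_rfl (by omega)
  have h2 := measurable_sigmaZ_Z (Q := Q) hi (by omega)
  have h3 := measurable_sigmaZ_Z (Q := Q) (r := j) (by omega) hj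
  unfold tau
  exact h1.sub ((h2.sub h1).mul (h3.sub h1)).sqrt

section GOE

variable {Ω : Type*} [MeasurableSpace Ω] {n : ℕ} {μ : Measure Ω}
  {Q : Ω → Matrix (Fin n) (Fin n) ℝ}

lemma IsGOE.measurable_diag (hQ : IsGOE μ Q) : Measurable fun ω i => Q ω i i :=
  measurable_pi_lambda _ fun i => hQ.measurable i i

lemma IsGOE.map_diag [IsProbabilityMeasure μ] (hQ : IsGOE μ Q) :
    μ.map (fun ω i => Q ω i i) = Measure.pi fun _ : Fin n => gaussianReal 0 1 := by
  have hind : iIndepFun (fun (i : Fin n) ω => Q ω i i) μ :=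
    hQ.indep.precomp (g := fun i : Fin n => (⟨(i, i), le_rfl⟩ : {e : Fin n × Fin n // e.1 ≤ e.2}))
      fun i j h => by simpa using h
  rw [(iIndepFun_iff_map_fun_eq_pi_map fun i => (hQ.measurable i i).aemeasurable).1 hind]
  simp only [hQ.diag]

lemma IsGOE.indepFun_diag_of_lt (hQ : IsGOE μ Q) {a b : Fin n} (hab : a < b) :
    IndepFun (fun ω i => Q ω i i) (fun ω => Q ω a b) μ := by
  classical
  let S : Finset {e : Fin n × Fin n // e.1 ≤ e.2} := Finset.univ.filter fun e => e.1.1 = e.1.2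
  let T : Finset {e : Fin n × Fin n // e.1 ≤ e.2} := {⟨(a, b), hab.le⟩}
  have hST : Disjoint S T := by
    rw [Finset.disjoint_singleton_right]
    simp [S, hab.ne]
  have h := hQ.indep.indepFun_finset S T hST fun e => hQ.measurable _ _
  exact h.comp (φ := fun f i => f ⟨⟨(i, i), le_rfl⟩, by simp [S]⟩)
    (ψ := fun f => f ⟨⟨(a, b), hab.le⟩, Finset.mem_singleton_self _⟩)
    (measurable_pi_lambda _ fun i => measurable_pi_apply (X := fun _ : S => ℝ) _)
    (measurable_pi_apply (X := fun _ : T => ℝ) _)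

lemma IsGOE.apply_comm (hQ : IsGOE μ Q) (ω : Ω) (a b : Fin n) : Q ω a b = Q ω b a :=
  (hQ.symm ω).apply b a

lemma IsGOE.indepFun_diag (hQ : IsGOE μ Q) {a b : Fin n} (hab : a ≠ b) :
    IndepFun (fun ω i => Q ω i i) (fun ω => Q ω a b) μ := by
  rcases hab.lt_or_gt with h | h
  · exact hQ.indepFun_diag_of_lt h
  · simp only [hQ.apply_comm _ a b]
    exact hQ.indepFun_diag_of_lt h

lemma IsGOE.map_offDiag (hQ : IsGOE μ Q) {a b : Fin n} (hab : a ≠ b) :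
    μ.map (fun ω => Q ω a b) = gaussianReal 0 (1 / 2) := by
  rcases hab.lt_or_gt with h | h
  · exact hQ.offDiag a b h
  · simp only [hQ.apply_comm _ a b]
    exact hQ.offDiag b a h

lemma IsGOE.measurable_Z (hQ : IsGOE μ Q) (r : ℕ) : Measurable fun ω => Z (Q ω) r := by
  simp only [Z_eq_orderStat]
  exact (measurable_orderStat r).comp hQ.measurable_diag

lemma IsGOE.sigmaZ_le (hQ : IsGOE μ Q) : sigmaZ Q ≤ ‹MeasurableSpace Ω› := by
  rw [sigmaZ, ← measurable_iff_comap_le]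
  exact measurable_pi_lambda _ fun r => hQ.measurable_Z _

lemma IsGOE.measurable_tau (hQ : IsGOE μ Q) (i j : ℕ) : Measurable fun ω => tau (Q ω) i j := by
  simp only [tau_eq_diagTau]
  exact (measurable_diagTau i j).comp hQ.measurable_diag

lemma X_eq {M : Matrix (Fin n) (Fin n) ℝ} {i j : ℕ} (hi : i - 1 < n) (hj : j - 1 < n) :
    X M i j = M (Tuple.sort (fun k => M k k) ⟨i - 1, hi⟩)
      (Tuple.sort (fun k => M k k) ⟨j - 1, hj⟩) := by
  unfold X reordered perm
  rw [dif_pos ⟨hi, hj⟩]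

lemma IsGOE.measurable_X (hQ : IsGOE μ Q) (i j : ℕ) : Measurable fun ω => X (Q ω) i j := by
  unfold X reordered perm
  by_cases h : i - 1 < n ∧ j - 1 < n
  · simp only [h, and_self, dif_pos]
    exact measurable_sort_apply (g := fun σ ω => Q ω (σ ⟨i - 1, h.1⟩) (σ ⟨j - 1, h.2⟩))
      hQ.measurable_diag fun σ => hQ.measurable _ _
  · simp [h]

lemma IsGOE.measurable_q (hQ : IsGOE μ Q) : Measurable (q Q) :=
  continuous_Phi.measurable.comp ((hQ.measurable_Z 1).const_mul _)

/-- The conditional pair probabilities. -/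
theorem IsGOE.p_ae_eq [IsProbabilityMeasure μ] (hQ : IsGOE μ Q) {i j : ℕ} (hi : 1 ≤ i) (hij : i < j) (hj : j ≤ n) :
    p μ Q i j =ᵐ[μ] fun ω => Phi (√2 * tau (Q ω) i j) := by
  classical
  have hin : i - 1 < n := by omega
  have hjn : j - 1 < n := by omega
  have hF : MeasurableSet (F Q i j) := measurableSet_lt (hQ.measurable_X i j) (hQ.measurable_tau i j)
  have hfint : Integrable ((F Q i j).indicator fun _ => (1 : ℝ)) μ :=
    (integrable_const (1 : ℝ)).indicator hF
  have hPhim : Measurable[sigmaZ Q] fun ω => Phi (√2 * tau (Q ω) i j) :=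
    continuous_Phi.measurable.comp ((measurable_sigmaZ_tau hi hij hj).const_mul _)
  have hgint : Integrable (fun ω => Phi (√2 * tau (Q ω) i j)) μ :=
    Integrable.of_bound (hPhim.mono hQ.sigmaZ_le le_rfl).aestronglyMeasurable 1
      (Eventually.of_forall fun ω => by
        rw [Real.norm_of_nonneg (Phi_pos _).le]; exact (Phi_lt_one _).le)
  refine (ae_eq_condExp_of_forall_setIntegral_eq hQ.sigmaZ_le hfint
    (fun _ _ _ => hgint.integrableOn) (fun s hs _ => ?_) hPhim.aestronglyMeasurable).symm
  obtain ⟨T, hT, rfl⟩ := hs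
  have hZm : Measurable fun (x : Fin n → ℝ) (r : Fin n) => orderStat x (r + 1) :=
    measurable_pi_lambda _ fun r => measurable_orderStat _
  -- Split according to the value `σ` of the sorting permutation. On each piece `X_ij` is one fixed
  -- entry of `Q`, independent of the diagonal. The pieces need not lie in `sigmaZ Q`, but they are
  -- events of the diagonal, which is all that the freezing lemma asks for.
  have hs_eq : (fun ω (r : Fin n) => Z (Q ω) (r + 1)) ⁻¹' T = ⋃ σ ∈ (Finset.univ : Finset
      (Equiv.Perm (Fin n))), (fun ω k => Q ω k k) ⁻¹'
        ((fun (x : Fin n → ℝ) (r : Fin n) => orderStat x (r + 1)) ⁻¹' T ∩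
          {x | Tuple.sort x = σ}) := by
    ext ω
    simp [Z_eq_orderStat]
  have hmeas : ∀ σ, MeasurableSet ((fun ω k => Q ω k k) ⁻¹'
        ((fun (x : Fin n → ℝ) (r : Fin n) => orderStat x (r + 1)) ⁻¹' T ∩
          {x | Tuple.sort x = σ})) := fun σ =>
    hQ.measurable_diag ((hZm hT).inter (measurableSet_sort_eq σ))
  have hdisj : Set.Pairwise (↑(Finset.univ : Finset (Equiv.Perm (Fin n))))
      (Function.onFun Disjoint fun σ => (fun ω k => Q ω k k) ⁻¹'
        ((fun (x : Fin n → ℝ) (r : Fin n) => orderStat x (r + 1)) ⁻¹' T ∩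
          {x | Tuple.sort x = σ})) := by
    intro σ _ σ' _ h
    refine Set.disjoint_left.2 fun ω h1 h2 => h ?_
    exact h1.2.symm.trans h2.2
  rw [hs_eq, integral_biUnion_finset _ (fun σ _ => hmeas σ) hdisj fun _ _ => hgint.integrableOn,
    integral_biUnion_finset _ (fun σ _ => hmeas σ) hdisj fun _ _ => hfint.integrableOn]
  refine Finset.sum_congr rfl fun σ _ => ?_
  have hne : σ ⟨i - 1, hin⟩ ≠ σ ⟨j - 1, hjn⟩ := by
    rw [σ.injective.ne_iff, Ne, Fin.mk.injEq]; omega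
  have key := setIntegral_indicator_lt_eq hQ.measurable_diag (hQ.measurable _ _)
    (hQ.indepFun_diag hne) (hQ.map_offDiag hne) (measurable_diagTau i j)
    ((hZm hT).inter (measurableSet_sort_eq σ))
  simp only [tau_eq_diagTau]
  rw [← key]
  refine setIntegral_congr_fun (hmeas σ) fun ω hω => ?_
  have hσ : Tuple.sort (fun k => Q ω k k) = σ := hω.2
  simp only [Set.indicator, F, Set.mem_ofPred_eq, tau_eq_diagTau, X_eq hin hjn, hσ]

end GOE

/-! ### Integrating out the two smallest of independent coordinates. -/

section LowPair

variable {γ : Measure ℝ} [IsProbabilityMeasure γ]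

lemma ae_pi_injective [NullSingletonClass γ] (n : ℕ) :
    ∀ᵐ x ∂(Measure.pi fun _ : Fin n => γ), Function.Injective x := by
  have h : ∀ i j : Fin n, i ≠ j → ∀ᵐ x ∂(Measure.pi fun _ : Fin n => γ), x i ≠ x j := by
    intro i j hij
    have hind : IndepFun (fun x : Fin n → ℝ => x i) (fun x => x j)
        (Measure.pi fun _ : Fin n => γ) :=
      (iIndepFun_pi (μ := fun _ : Fin n => γ) (X := fun _ x => x)
        fun _ => aemeasurable_id).indepFun hij
    have hmap := (indepFun_iff_map_prod_eq_prod_map_map (measurable_pi_apply i).aemeasurable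
      (measurable_pi_apply j).aemeasurable).1 hind
    have hmp : ∀ i : Fin n, (Measure.pi fun _ : Fin n => γ).map (fun x => x i) = γ := fun i =>
      (measurePreserving_eval (fun _ : Fin n => γ) i).map_eq
    rw [hmp, hmp] at hmap
    have hdiag : MeasurableSet {z : ℝ × ℝ | z.1 = z.2} :=
      measurableSet_eq_fun measurable_fst measurable_snd
    have hnull : (γ.prod γ) {z : ℝ × ℝ | z.1 = z.2} = 0 := by
      rw [Measure.measure_prod_null hdiag]
      refine Eventually.of_forall fun x => ?_
      have : Prod.mk x ⁻¹' {z : ℝ × ℝ | z.1 = z.2} = {x} := by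
        ext y; simp [eq_comm]
      simp only [this, Pi.zero_apply, measure_singleton]
    rw [← hmap, Measure.map_apply ((measurable_pi_apply i).prodMk (measurable_pi_apply j)) hdiag]
      at hnull
    rw [ae_iff]
    simpa using hnull
  have h' : ∀ᵐ x ∂(Measure.pi fun _ : Fin n => γ), ∀ i j : Fin n, i ≠ j → x i ≠ x j := by
    rw [ae_all_iff]; intro i
    rw [ae_all_iff]; intro j
    by_cases hij : i = j
    · simp [hij]
    · filter_upwards [h i j hij] with x hx _ using hx
  filter_upwards [h'] with x hx i j hij
  by_contra hne
  exact hx i j hne hij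

variable {m : ℕ}

/-- Coordinate `a` is the smallest and `a.succAbove b` the second smallest one. -/
def LowPair (a : Fin (m + 2)) (b : Fin (m + 1)) (x : Fin (m + 2) → ℝ) : Prop :=
  x a < x (a.succAbove b) ∧ ∀ k, x (a.succAbove b) < x (a.succAbove (b.succAbove k))

lemma LowPair.lt {a : Fin (m + 2)} {b : Fin (m + 1)} {x : Fin (m + 2) → ℝ} (h : LowPair a b x)
    {i : Fin (m + 2)} (hi : i ≠ a) : x a < x i := by
  obtain ⟨j, rfl⟩ := Fin.exists_succAbove_eq hi
  by_cases hj : j = b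
  · rw [hj]; exact h.1
  · obtain ⟨k, rfl⟩ := Fin.exists_succAbove_eq hj
    exact h.1.trans (h.2 k)

lemma LowPair.snd_lt {a : Fin (m + 2)} {b : Fin (m + 1)} {x : Fin (m + 2) → ℝ}
    (h : LowPair a b x) {i : Fin (m + 2)} (hi : i ≠ a) (hi' : i ≠ a.succAbove b) :
    x (a.succAbove b) < x i := by
  obtain ⟨j, rfl⟩ := Fin.exists_succAbove_eq hi
  obtain ⟨k, rfl⟩ := Fin.exists_succAbove_eq (fun hj => hi' (by rw [hj]) : j ≠ b)
  exact h.2 k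

lemma exists_lowPair {x : Fin (m + 2) → ℝ} (hx : Function.Injective x) :
    ∃ a b, LowPair a b x := by
  obtain ⟨a, ha⟩ := Finite.exists_min x
  obtain ⟨b, hb⟩ := Finite.exists_min fun j => x (a.succAbove j)
  refine ⟨a, b, (ha _).lt_of_ne fun h => ?_, fun k => (hb _).lt_of_ne fun h => ?_⟩
  · exact Fin.succAbove_ne a b (hx h).symm
  · exact Fin.succAbove_ne b k (Fin.succAbove_right_injective (hx h)).symm

lemma LowPair.unique {a a' : Fin (m + 2)} {b b' : Fin (m + 1)} {x : Fin (m + 2) → ℝ}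
    (h : LowPair a b x) (h' : LowPair a' b' x) : a = a' ∧ b = b' := by
  have ha : a = a' := by
    by_contra hne
    exact lt_asymm (h.lt (Ne.symm hne)) (h'.lt hne)
  subst ha
  refine ⟨rfl, ?_⟩
  by_contra hne
  have h1 := h.snd_lt (Fin.succAbove_ne a b') (fun h => hne (Fin.succAbove_right_injective h).symm)
  have h2 := h'.snd_lt (Fin.succAbove_ne a b) (fun h => hne (Fin.succAbove_right_injective h))
  exact lt_asymm h1 h2

open Classical in
/-- The expectation of a function of the two smallest values and of the remaining ones. -/
theorem integral_pi_eq_of_lowPair [NullSingletonClass γ] {F : (Fin (m + 2) → ℝ) → ℝ}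
    {K : ℝ → ℝ → (Fin m → ℝ) → ℝ} {C : ℝ}
    (hK : Measurable fun z : ℝ × ℝ × (Fin m → ℝ) => K z.1 z.2.1 z.2.2)
    (hC : ∀ y z w, |K y z w| ≤ C)
    (hF : ∀ x a b, LowPair a b x →
      F x = K (x a) (x (a.succAbove b)) fun k => x (a.succAbove (b.succAbove k))) :
    ∫ x, F x ∂(Measure.pi fun _ : Fin (m + 2) => γ) =
      (m + 2) * (m + 1) * ∫ y, ∫ z, ∫ w, (if y < z ∧ ∀ k, z < w k then K y z w else 0)
        ∂(Measure.pi fun _ : Fin m => γ) ∂γ ∂γ := by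
  have hC0 : 0 ≤ C := (abs_nonneg _).trans (hC 0 0 0)
  set Kt : ℝ → ℝ → (Fin m → ℝ) → ℝ := fun y z w =>
    if y < z ∧ ∀ k, z < w k then K y z w else 0 with hKt
  have hKtm : Measurable fun z : ℝ × ℝ × (Fin m → ℝ) => Kt z.1 z.2.1 z.2.2 := by
    refine Measurable.ite ?_ hK measurable_const
    refine (measurableSet_lt measurable_fst (by fun_prop)).inter ?_
    change MeasurableSet {z : ℝ × ℝ × (Fin m → ℝ) | ∀ k, z.2.1 < z.2.2 k}
    rw [Set.ofPred_forall]
    exact MeasurableSet.iInter fun k => measurableSet_lt (by fun_prop) (by fun_prop)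
  have hKtC : ∀ y z w, ‖Kt y z w‖ ≤ C := by
    intro y z w
    simp only [hKt]
    split_ifs
    · exact hC y z w
    · simpa using hC0
  -- Almost surely there are no ties, and then exactly one pair `(a, b)` satisfies `LowPair`, so the
  -- double sum has a single nonzero term.
  have hae : F =ᵐ[Measure.pi fun _ : Fin (m + 2) => γ] fun x => ∑ a, ∑ b,
      Kt (x a) (x (a.succAbove b)) fun k => x (a.succAbove (b.succAbove k)) := by
    filter_upwards [ae_pi_injective (m + 2)] with x hx
    obtain ⟨a, b, hab⟩ := exists_lowPair hx
    rw [Finset.sum_eq_single a, Finset.sum_eq_single b, hF x a b hab]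
    · exact (if_pos hab).symm
    · intro b' _ hb'
      simp only [hKt]
      exact if_neg fun h : LowPair a b' x => hb' (h.unique hab).2
    · simp
    · intro a' _ ha'
      refine Finset.sum_eq_zero fun b' _ => ?_
      simp only [hKt]
      exact if_neg fun h : LowPair a' b' x => ha' (h.unique hab).1
    · simp
  have hint : ∀ (a : Fin (m + 2)) (b : Fin (m + 1)), Integrable (fun x : Fin (m + 2) → ℝ =>
      Kt (x a) (x (a.succAbove b)) fun k => x (a.succAbove (b.succAbove k)))
      (Measure.pi fun _ : Fin (m + 2) => γ) := fun a b =>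
    Integrable.of_bound (hKtm.comp (f := fun x : Fin (m + 2) → ℝ => (x a, x (a.succAbove b),
      fun k => x (a.succAbove (b.succAbove k)))) (by fun_prop)).aestronglyMeasurable C
      (Eventually.of_forall fun x => hKtC _ _ _)
  -- Splitting off coordinate `a` and then `b` preserves the product measure, so all `(m+2)(m+1)`
  -- pairs contribute the same iterated integral.
  have hone : ∀ (a : Fin (m + 2)) (b : Fin (m + 1)), ∫ x : Fin (m + 2) → ℝ,
      (Kt (x a) (x (a.succAbove b)) fun k => x (a.succAbove (b.succAbove k)))
      ∂(Measure.pi fun _ : Fin (m + 2) => γ) =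
      ∫ y, ∫ z, ∫ w, Kt y z w ∂(Measure.pi fun _ : Fin m => γ) ∂γ ∂γ := by
    intro a b
    have h1 := (measurePreserving_piFinSuccAbove (fun _ : Fin (m + 2) => γ) a).integral_comp'
      (g := fun z : ℝ × (Fin (m + 1) → ℝ) => Kt z.1 (z.2 b) fun k => z.2 (b.succAbove k))
    refine Eq.trans ?_ (h1.trans ?_)
    · rfl
    rw [integral_prod]
    · refine integral_congr_ae (Eventually.of_forall fun y => ?_)
      have h2 := (measurePreserving_piFinSuccAbove (fun _ : Fin (m + 1) => γ) b).integral_comp'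
        (g := fun z : ℝ × (Fin m → ℝ) => Kt y z.1 z.2)
      refine Eq.trans ?_ (h2.trans ?_)
      · rfl
      rw [integral_prod]
      exact Integrable.of_bound (hKtm.comp (f := fun z : ℝ × (Fin m → ℝ) => (y, z.1, z.2))
        (by fun_prop)).aestronglyMeasurable C (Eventually.of_forall fun x => hKtC _ _ _)
    · exact Integrable.of_bound (hKtm.comp (f := fun z : ℝ × (Fin (m + 1) → ℝ) =>
        (z.1, z.2 b, fun k => z.2 (b.succAbove k)))
        (by fun_prop)).aestronglyMeasurable C (Eventually.of_forall fun x => hKtC _ _ _)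
  rw [integral_congr_ae hae, integral_finsetSum _ fun a _ => integrable_finsetSum _
    fun b _ => hint a b]
  simp_rw [integral_finsetSum _ fun b _ => hint _ b, hone]
  simp [Finset.sum_const, Finset.card_univ]
  ring

open Classical in
lemma integral_pi_ite_const (y z c : ℝ) :
    ∫ w, (if y < z ∧ ∀ k, z < w k then c else 0) ∂(Measure.pi fun _ : Fin m => γ) =
      if y < z then c * γ.real (Set.Ioi z) ^ m else 0 := by
  by_cases h : y < z
  · have hs : MeasurableSet (Set.univ.pi fun _ : Fin m => Set.Ioi z) :=
      MeasurableSet.univ_pi fun _ => measurableSet_Ioi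
    have : ∀ w : Fin m → ℝ, (if y < z ∧ ∀ k, z < w k then c else 0) =
        (Set.univ.pi fun _ : Fin m => Set.Ioi z).indicator (fun _ => c) w := fun w => by
      simp [Set.indicator, h]
    simp only [this]
    rw [integral_indicator_const _ hs, measureReal_def, Measure.pi_pi]
    simp [h, measureReal_def, mul_comm]
  · simp [h]

-- Each summand is a product over coordinates, `g` restricted to `(z, ∞)` at one index and an
-- indicator at the others, so its integral factorises.
open Classical in
lemma integral_pi_ite_sum {g : ℝ → ℝ} (hg : Measurable g) {C : ℝ} (hC : ∀ x, |g x| ≤ C)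
    (y z : ℝ) :
    ∫ w, (if y < z ∧ ∀ k, z < w k then ∑ k, g (w k) else 0) ∂(Measure.pi fun _ : Fin m => γ) =
      if y < z then m * γ.real (Set.Ioi z) ^ (m - 1) * ∫ x in Set.Ioi z, g x ∂γ else 0 := by
  by_cases h : y < z
  · have hprod : ∀ w : Fin m → ℝ, (if y < z ∧ ∀ k, z < w k then ∑ k, g (w k) else 0) =
        ∑ k, ∏ l, (Set.Ioi z).indicator (if l = k then g else 1) (w l) := by
      intro w
      by_cases hw : ∀ k, z < w k
      · simp only [h, hw, implies_true, and_self, if_true]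
        refine Finset.sum_congr rfl fun k _ => ?_
        rw [Finset.prod_eq_single k]
        · simp [hw k]
        · intro l _ hl; simp [hl, hw l]
        · simp
      · simp only [hw, and_false, if_false]
        push Not at hw
        obtain ⟨l, hl⟩ := hw
        refine (Finset.sum_eq_zero fun k _ => Finset.prod_eq_zero (Finset.mem_univ l) ?_).symm
        simp [hl]
    have hm : ∀ k l : Fin m, Measurable ((Set.Ioi z).indicator (if l = k then g else 1)) := by
      intro k l
      refine Measurable.indicator ?_ measurableSet_Ioi
      split_ifs
      · exact hg
      · exact measurable_const
    have hint : ∀ k l : Fin m, Integrable ((Set.Ioi z).indicator (if l = k then g else 1)) γ := by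
      intro k l
      refine Integrable.of_bound (hm k l).aestronglyMeasurable (max C 1)
        (Eventually.of_forall fun x => ?_)
      refine (norm_indicator_le_norm_self _ _).trans ?_
      split_ifs
      · exact (hC x).trans (le_max_left _ _)
      · simp
    simp only [hprod]
    rw [if_pos h]
    rw [integral_finsetSum _ fun k _ => Integrable.fintype_prod (hint k)]
    have hone : ∀ k : Fin m, ∫ w : Fin m → ℝ, ∏ l, (Set.Ioi z).indicator
        (if l = k then g else 1) (w l) ∂(Measure.pi fun _ : Fin m => γ) =
        γ.real (Set.Ioi z) ^ (m - 1) * ∫ x in Set.Ioi z, g x ∂γ := by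
      intro k
      rw [integral_fintype_prod_eq_prod (fun l => (Set.Ioi z).indicator (if l = k then g else 1)),
        ← Finset.mul_prod_erase _ _ (Finset.mem_univ k), mul_comm]
      congr 1
      · rw [Finset.prod_congr rfl (g := fun _ => γ.real (Set.Ioi z))]
        · simp
        · intro l hl
          rw [if_neg (Finset.ne_of_mem_erase hl), integral_indicator_one measurableSet_Ioi]
      · simp [integral_indicator measurableSet_Ioi]
    simp only [hone]
    simp
    ring
  · simp [h]

end LowPair

/-! ### Passage to uniform variables and the formula for `I_n`. -/

lemma measurable_Phi : Measurable Phi := continuous_Phi.measurable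

/-- The probability integral transform, checked on half-lines, which determine a finite measure on
the line. -/
lemma measurePreserving_Phi :
    MeasurePreserving Phi (gaussianReal 0 1) (volume.restrict (Set.Ioo 0 1)) := by
  refine ⟨measurable_Phi, ?_⟩
  have := Measure.isProbabilityMeasure_map (μ := gaussianReal 0 1) measurable_Phi.aemeasurable
  refine Measure.ext_of_Iic _ _ fun u => ?_
  rw [Measure.map_apply measurable_Phi measurableSet_Iic, Measure.restrict_apply measurableSet_Iic]
  rcases le_or_gt u 0 with h0 | h0
  · have h1 : Phi ⁻¹' Set.Iic u = ∅ := by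
      ext x; simpa using h0.trans_lt (Phi_pos x)
    have h2 : Set.Iic u ∩ Set.Ioo 0 1 = ∅ := by
      ext x; simp only [Set.mem_inter_iff, Set.mem_Iic, Set.mem_Ioo, Set.mem_empty_iff_false,
        iff_false, not_and]
      intro h h'; linarith
    rw [h1, h2]; simp
  · rcases lt_or_ge u 1 with h1 | h1
    · have h2 : Phi ⁻¹' Set.Iic u = Set.Iic (PhiInv u) := by
        ext x
        simp only [Set.mem_preimage, Set.mem_Iic]
        rw [← strictMono_Phi.le_iff_le (b := PhiInv u), Phi_PhiInv ⟨h0, h1⟩]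
      have h3 : Set.Iic u ∩ Set.Ioo 0 1 = Set.Ioc 0 u := by
        ext x; simp only [Set.mem_inter_iff, Set.mem_Iic, Set.mem_Ioo, Set.mem_Ioc]
        constructor
        · rintro ⟨h, h', _⟩; exact ⟨h', h⟩
        · rintro ⟨h, h'⟩; exact ⟨h', h, h'.trans_lt h1⟩
      rw [h2, h3, ← ofReal_cdf, Real.volume_Ioc, sub_zero]
      congr 1
      exact Phi_PhiInv ⟨h0, h1⟩
    · have h2 : Phi ⁻¹' Set.Iic u = Set.univ := by
        ext x; simpa using (Phi_lt_one x).le.trans h1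
      have h3 : Set.Iic u ∩ Set.Ioo 0 1 = Set.Ioo 0 1 := by
        rw [Set.inter_eq_right]
        exact fun x hx => hx.2.le.trans h1
      rw [h2, h3]; simp

lemma integral_comp_Phi (h : ℝ → ℝ) :
    ∫ x, h (Phi x) ∂gaussianReal 0 1 = ∫ u in (0 : ℝ)..1, h u := by
  rw [measurePreserving_Phi.integral_comp measurableEmbedding_Phi,
    intervalIntegral.integral_of_le zero_le_one, integral_Ioc_eq_integral_Ioo]

lemma setIntegral_Ioi_comp_Phi (h : ℝ → ℝ) (z : ℝ) :
    ∫ x in Set.Ioi z, h (Phi x) ∂gaussianReal 0 1 = ∫ w in Phi z..1, h w := by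
  have hpre : Set.Ioi z = Phi ⁻¹' Set.Ioi (Phi z) := by
    ext x; simp [strictMono_Phi.lt_iff_lt]
  rw [hpre, measurePreserving_Phi.setIntegral_preimage_emb measurableEmbedding_Phi,
    Measure.restrict_restrict measurableSet_Ioi,
    intervalIntegral.integral_of_le (Phi_lt_one z).le, integral_Ioc_eq_integral_Ioo]
  congr 2
  ext x
  simp only [Set.mem_inter_iff, Set.mem_Ioi, Set.mem_Ioo]
  exact ⟨fun h => ⟨h.1, h.2.2⟩, fun h => ⟨h.1, (Phi_pos z).trans h.1, h.2⟩⟩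

lemma measurable_pairProb :
    Measurable fun z : ℝ × ℝ × ℝ => pairProb z.1 z.2.1 z.2.2 := by
  have := measurable_PhiInv
  have := measurable_Phi
  unfold pairProb
  fun_prop

lemma pairProb_pos (u v w : ℝ) : 0 < pairProb u v w := Phi_pos _

lemma pairProb_le_one (u v w : ℝ) : pairProb u v w ≤ 1 := (Phi_lt_one _).le

lemma abs_pairProb_le_one (u v w : ℝ) : |pairProb u v w| ≤ 1 := by
  rw [abs_of_pos (pairProb_pos u v w)]; exact pairProb_le_one u v w

lemma measurable_pairProb_right (u v : ℝ) : Measurable fun w => pairProb u v w :=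
  measurable_pairProb.comp (f := fun w => (u, v, w)) (by fun_prop)

lemma intervalIntegrable_pairProb (u v a b : ℝ) :
    IntervalIntegrable (fun w => pairProb u v w) volume a b := by
  rw [intervalIntegrable_iff]
  exact Measure.integrableOn_of_bounded (f := fun w => pairProb u v w) (M := 1) (by simp)
    (measurable_pairProb_right u v).aestronglyMeasurable
    (Eventually.of_forall fun w => abs_pairProb_le_one u v w)

lemma measurable_intervalIntegral {α : Type*} [MeasurableSpace α] {f : α → ℝ → ℝ}
    (hf : Measurable fun z : α × ℝ => f z.1 z.2) {a b : α → ℝ} (ha : Measurable a)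
    (hb : Measurable b) : Measurable fun z => ∫ w in a z..b z, f z w := by
  have h : ∀ c d : α → ℝ, Measurable c → Measurable d →
      Measurable fun z => ∫ w in Set.Ioc (c z) (d z), f z w := by
    intro c d hc hd
    have hs : MeasurableSet {z : α × ℝ | z.2 ∈ Set.Ioc (c z.1) (d z.1)} :=
      (measurableSet_lt (hc.comp measurable_fst) measurable_snd).inter
        (measurableSet_le measurable_snd (hd.comp measurable_fst))
    have := (hf.indicator hs).stronglyMeasurable.integral_prod_right' (ν := volume)
    convert this.measurable using 2 with z
    rw [← integral_indicator measurableSet_Ioc]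
    rfl
  unfold intervalIntegral
  exact (h a b ha hb).sub (h b a hb ha)

lemma measurable_G : Measurable fun z : ℝ × ℝ => G z.1 z.2 := by
  unfold G
  refine Measurable.mul (by fun_prop) (measurable_intervalIntegral ?_ measurable_snd
    measurable_const)
  exact measurable_pairProb.comp (f := fun z : (ℝ × ℝ) × ℝ => (z.1.1, z.1.2, z.2)) (by fun_prop)

lemma measurable_G_right (u : ℝ) : Measurable fun v => G u v :=
  measurable_G.comp (f := fun v => (u, v)) (by fun_prop)

/-- Needed for all real arguments, since `IsGOE.integral_U` asks for a bound everywhere. At `v = 1`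
division by zero makes `G` vanish. -/
lemma abs_G_le_one (u v : ℝ) : |G u v| ≤ 1 := by
  have h := intervalIntegral.norm_integral_le_of_norm_le_const (a := v) (b := 1) (C := 1)
    (f := fun w => pairProb u v w)
    fun w _ => abs_pairProb_le_one u v w
  rw [one_mul, Real.norm_eq_abs] at h
  rw [G, abs_mul, abs_div, abs_one]
  rcases eq_or_ne (1 - v) 0 with h0 | h0
  · simp [h0]
  · rw [one_div, ← div_eq_inv_mul, div_le_one (abs_pos.2 h0)]
    exact h

lemma G_nonneg {u v : ℝ} (hv : v < 1) : 0 ≤ G u v :=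
  mul_nonneg (by rw [one_div, inv_nonneg]; linarith)
    (intervalIntegral.integral_nonneg hv.le fun _ _ => (pairProb_pos _ _ _).le)

lemma G_mul_one_sub {u v : ℝ} (hv : v < 1) : G u v * (1 - v) = ∫ w in v..1, pairProb u v w := by
  have : 1 - v ≠ 0 := by linarith
  unfold G
  field_simp

section

variable {m : ℕ} {a : Fin (m + 2)} {b : Fin (m + 1)} {x : Fin (m + 2) → ℝ}

lemma LowPair.sort_zero (h : LowPair a b x) : Tuple.sort x 0 = a := by
  by_contra hne
  obtain ⟨k, hk⟩ := (Tuple.sort x).surjective a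
  have h1 := Tuple.monotone_sort x (Fin.zero_le k)
  simp only [Function.comp_apply, hk] at h1
  exact (h.lt hne).not_ge h1

lemma LowPair.sort_one (h : LowPair a b x) : Tuple.sort x 1 = a.succAbove b := by
  by_contra hne
  obtain ⟨k, hk⟩ := (Tuple.sort x).surjective (a.succAbove b)
  have hk0 : k ≠ 0 := by
    rintro rfl
    rw [h.sort_zero] at hk
    exact Fin.succAbove_ne a b hk.symm
  have h1 := Tuple.monotone_sort x (Fin.one_le_of_ne_zero hk0)
  simp only [Function.comp_apply, hk] at h1
  refine (h.snd_lt (fun h2 => ?_) hne).not_ge h1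
  rw [← h.sort_zero, (Tuple.sort x).injective.eq_iff] at h2
  exact one_ne_zero h2

lemma LowPair.orderStat_one (h : LowPair a b x) : orderStat x 1 = x a := by
  rw [orderStat, dif_pos (by omega)]
  exact congrArg x h.sort_zero

lemma LowPair.orderStat_two (h : LowPair a b x) : orderStat x 2 = x (a.succAbove b) := by
  rw [orderStat, dif_pos (by omega)]
  exact congrArg x h.sort_one

/-- Sorting permutes the coordinates, so the full sums agree; cancelling the two smallest terms
leaves the claim. -/
lemma LowPair.sum_orderStat (h : LowPair a b x) (g : ℝ → ℝ) :
    ∑ j ∈ Finset.Icc 3 (m + 2), g (orderStat x j) =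
      ∑ k, g (x (a.succAbove (b.succAbove k))) := by
  have h1 : ∑ i, g (x (Tuple.sort x i)) = ∑ i, g (x i) :=
    Equiv.sum_comp (Tuple.sort x) fun i => g (x i)
  rw [Fin.sum_univ_succ, Fin.sum_univ_succ, Fin.sum_univ_succAbove _ a,
    Fin.sum_univ_succAbove _ b, h.sort_zero, Fin.succ_zero_eq_one, h.sort_one] at h1
  have h2 : ∑ j ∈ Finset.Icc 3 (m + 2), g (orderStat x j) =
      ∑ i : Fin m, g (x (Tuple.sort x i.succ.succ)) := by
    have : Finset.Icc 3 (m + 2) = (Finset.range m).image (· + 3) := by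
      ext j
      simp only [Finset.mem_Icc, Finset.mem_image, Finset.mem_range]
      constructor
      · rintro ⟨h, h'⟩; exact ⟨j - 3, by omega, by omega⟩
      · rintro ⟨k, hk, rfl⟩; omega
    rw [this, Finset.sum_image (by intro i _ j _ h; simpa using h), Finset.sum_range]
    refine Finset.sum_congr rfl fun i _ => ?_
    rw [orderStat, dif_pos (by omega)]
    rfl
  rw [h2]
  linarith

end

instance : NullSingletonClass (gaussianReal 0 1) := nullSingletonClass_gaussianReal one_ne_zero

section GOE

variable {Ω : Type*} [MeasurableSpace Ω] {μ : Measure Ω} [IsProbabilityMeasure μ] {m : ℕ}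
  {Q : Ω → Matrix (Fin (m + 2)) (Fin (m + 2)) ℝ}

/-- The joint law of `U_(1)` and `U_(2)`. -/
theorem IsGOE.integral_U (hQ : IsGOE μ Q) {h : ℝ → ℝ → ℝ}
    (hm : Measurable fun z : ℝ × ℝ => h z.1 z.2) {C : ℝ} (hC : ∀ u v, |h u v| ≤ C) :
    ∫ ω, h (U Q 1 ω) (U Q 2 ω) ∂μ =
      (m + 2) * (m + 1) * ∫ u in (0 : ℝ)..1, ∫ v in u..1, (1 - v) ^ m * h u v := by
  classical
  have hPhi := measurable_Phi
  have h1 : ∫ ω, h (U Q 1 ω) (U Q 2 ω) ∂μ =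
      ∫ x : Fin (m + 2) → ℝ, h (Phi (orderStat x 1)) (Phi (orderStat x 2))
        ∂(Measure.pi fun _ => gaussianReal 0 1) := by
    rw [← hQ.map_diag, integral_map hQ.measurable_diag.aemeasurable]
    · simp only [U, Z_eq_orderStat]
    · have h1 := measurable_orderStat (n := m + 2) 1
      have h2 := measurable_orderStat (n := m + 2) 2
      exact (hm.comp (f := fun x : Fin (m + 2) → ℝ => (Phi (orderStat x 1), Phi (orderStat x 2)))
        (by fun_prop)).aestronglyMeasurable
  rw [h1, integral_pi_eq_of_lowPair (K := fun y z _ => h (Phi y) (Phi z)) (C := C)]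
  · congr 1
    rw [← integral_comp_Phi fun u => ∫ v in u..1, (1 - v) ^ m * h u v]
    refine integral_congr_ae (Eventually.of_forall fun y => ?_)
    simp only [integral_pi_ite_const, gaussianReal_real_Ioi]
    rw [← setIntegral_Ioi_comp_Phi (fun v => (1 - v) ^ m * h (Phi y) v),
      ← integral_indicator measurableSet_Ioi]
    refine integral_congr_ae (Eventually.of_forall fun z => ?_)
    simp [Set.indicator, mul_comm]
  · exact hm.comp (f := fun z : ℝ × ℝ × (Fin m → ℝ) => (Phi z.1, Phi z.2.1)) (by fun_prop)
  · exact fun _ _ _ => hC _ _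
  · intro x a b hab
    rw [hab.orderStat_one, hab.orderStat_two]

lemma Phi_tau_eq_pairProb {n : ℕ} (M : Matrix (Fin n) (Fin n) ℝ) (i j : ℕ) :
    Phi (√2 * tau M i j) = pairProb (Phi (Z M 1)) (Phi (Z M i)) (Phi (Z M j)) := by
  simp only [tau, pairProb, PhiInv_Phi]

/-- The expected number of pairs at the second-smallest diagonal entry. -/
theorem IsGOE.integral_sum_eq_I (hQ : IsGOE μ Q) :
    ∫ ω, ∑ j ∈ Finset.Icc 3 (m + 2), Phi (√2 * tau (Q ω) 2 j) ∂μ = I μ Q := by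
  classical
  have hPhi := measurable_Phi
  have hmos := fun r => measurable_orderStat (n := m + 2) r
  have h1 : ∫ ω, ∑ j ∈ Finset.Icc 3 (m + 2), Phi (√2 * tau (Q ω) 2 j) ∂μ =
      ∫ x : Fin (m + 2) → ℝ, ∑ j ∈ Finset.Icc 3 (m + 2),
        pairProb (Phi (orderStat x 1)) (Phi (orderStat x 2)) (Phi (orderStat x j))
        ∂(Measure.pi fun _ => gaussianReal 0 1) := by
    rw [← hQ.map_diag, integral_map hQ.measurable_diag.aemeasurable]
    · simp only [Phi_tau_eq_pairProb, Z_eq_orderStat]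
    · refine (Finset.measurable_sum _ fun j _ => ?_).aestronglyMeasurable
      have := hmos j
      have := hmos 1
      have := hmos 2
      exact measurable_pairProb.comp (f := fun x : Fin (m + 2) → ℝ =>
        (Phi (orderStat x 1), Phi (orderStat x 2), Phi (orderStat x j))) (by fun_prop)
  rw [h1, integral_pi_eq_of_lowPair
    (K := fun y z w => ∑ k, pairProb (Phi y) (Phi z) (Phi (w k))) (C := m)]
  · rw [I, hQ.integral_U measurable_G abs_G_le_one]
    push_cast
    rw [show (m : ℝ) + 2 - 2 = m by ring, mul_left_comm, ← intervalIntegral.integral_const_mul]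
    congr 1
    simp_rw [← intervalIntegral.integral_const_mul]
    rw [← integral_comp_Phi fun u => ∫ v in u..1, (m : ℝ) * ((1 - v) ^ m * G u v)]
    refine integral_congr_ae (Eventually.of_forall fun y => ?_)
    simp only
    rw [← setIntegral_Ioi_comp_Phi (fun v => (m : ℝ) * ((1 - v) ^ m * G (Phi y) v)),
      ← integral_indicator measurableSet_Ioi]
    refine integral_congr_ae (Eventually.of_forall fun z => ?_)
    simp only
    rw [integral_pi_ite_sum (g := fun x => pairProb (Phi y) (Phi z) (Phi x))
      ((measurable_pairProb_right _ _).comp hPhi) (fun _ => abs_pairProb_le_one _ _ _),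
      gaussianReal_real_Ioi, setIntegral_Ioi_comp_Phi (fun w => pairProb (Phi y) (Phi z) w),
      ← G_mul_one_sub (Phi_lt_one z)]
    -- The factor `1 - v` from `G_mul_one_sub` raises the exponent from `m - 1` to `m`. For `m = 0`
    -- the truncated exponent does no harm, because of the factor `m`.
    by_cases hyz : y < z
    · rcases m with _ | m
      · simp
      · simp only [hyz, if_true, Set.mem_Ioi, Set.indicator_of_mem, Nat.add_sub_cancel, pow_succ]
        ring
    · simp [hyz]
  · refine Finset.measurable_sum _ fun k _ => ?_
    exact measurable_pairProb.comp (f := fun z : ℝ × ℝ × (Fin m → ℝ) =>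
      (Phi z.1, Phi z.2.1, Phi (z.2.2 k))) (by fun_prop)
  · intro y z w
    refine (Finset.abs_sum_le_sum_abs _ _).trans ?_
    refine (Finset.sum_le_sum fun k _ => abs_pairProb_le_one _ _ _).trans ?_
    simp
  · intro x a b hab
    rw [hab.orderStat_one, hab.orderStat_two]
    exact hab.sum_orderStat fun y => pairProb (Phi (x a)) (Phi (x (a.succAbove b))) (Phi y)

end GOE

/-! ### The second moment of `q_n` and the reduction of `A_n` to `I_n`. -/

lemma one_le_log_of_three_le {n : ℕ} (hn : 3 ≤ n) : 1 ≤ Real.log n := by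
  rw [Real.le_log_iff_exp_le (by positivity)]
  have : (3 : ℝ) ≤ n := by exact_mod_cast hn
  linarith [Real.exp_one_lt_d9]

lemma sq_neg_PhiInv_le {u : ℝ} (hu : u ∈ Set.Ioo (0 : ℝ) 1) (h : PhiInv u ≤ 0) :
    PhiInv u ^ 2 ≤ 2 * Real.log (1 / u) := by
  have h1 := Phi_neg_le_exp (b := -PhiInv u) (by linarith)
  rw [neg_neg, Phi_PhiInv hu] at h1
  have h2 := Real.log_le_log hu.1 h1
  rw [Real.log_exp] at h2
  rw [one_div, Real.log_inv]
  nlinarith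

/-- A majorant that is polynomial in `u`, ready for Beta-type integrals. For small `u` the left side
is at most `64 s² u⁴` with `s² ≤ 2 log(1/u)`, and `log(1/u) ≤ log n + 1/(nu)` removes the logarithm
of `u`. For `u ≥ Phi(-1)` the trivial bound `1` goes into the second part of the constant. -/
lemma Phi_sqrt_two_PhiInv_sq_le {u : ℝ} (hu : u ∈ Set.Ioo (0 : ℝ) 1) {n : ℕ} (hn : 3 ≤ n) :
    Phi (√2 * PhiInv u) ^ 2 ≤
      (128 + 1 / Phi (-1) ^ 4) * (Real.log n * u ^ 4 + 1 / n * u ^ 3) := by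
  have hP := Phi_pos (-1)
  have hlog := one_le_log_of_three_le hn
  have hn0 : (0 : ℝ) < n := by exact_mod_cast (by omega : 0 < n)
  have hu0 := hu.1
  have hX : 0 ≤ Real.log n * u ^ 4 + 1 / n * u ^ 3 := by positivity
  rcases le_or_gt (PhiInv u) (-1) with hs | hs
  · have h1 : Phi (√2 * PhiInv u) ≤ 8 * (-PhiInv u) * u ^ 2 := by
      have := Phi_sqrt_two_le (s := -PhiInv u) (by linarith)
      rwa [mul_neg, neg_neg, neg_neg, Phi_PhiInv hu] at this
    have h2 := sq_neg_PhiInv_le hu (by linarith)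
    have h3 : Real.log (1 / u) ≤ Real.log n + 1 / (n * u) := by
      have : Real.log (1 / u) = Real.log n + Real.log (1 / (n * u)) := by
        rw [← Real.log_mul hn0.ne' (by positivity)]
        congr 1; field_simp
      rw [this]
      have := Real.log_le_sub_one_of_pos (x := 1 / (n * u)) (by positivity)
      linarith
    calc Phi (√2 * PhiInv u) ^ 2 ≤ (8 * (-PhiInv u) * u ^ 2) ^ 2 := by
          gcongr; exact (Phi_pos _).le
      _ = 64 * u ^ 4 * PhiInv u ^ 2 := by ring
      _ ≤ 64 * u ^ 4 * (2 * (Real.log n + 1 / (n * u))) := by gcongr; linarith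
      _ = 128 * (Real.log n * u ^ 4 + 1 / n * u ^ 3) := by field_simp; ring
      _ ≤ _ := by
        gcongr
        have : 0 < 1 / Phi (-1) ^ 4 := by positivity
        linarith
  · have h1 : Phi (-1) ≤ u := by
      have := strictMono_Phi hs
      rw [Phi_PhiInv hu] at this
      exact this.le
    calc Phi (√2 * PhiInv u) ^ 2 ≤ 1 := pow_le_one₀ (Phi_pos _).le (Phi_lt_one _).le
      _ = 1 / Phi (-1) ^ 4 * (1 * Phi (-1) ^ 4) := by field_simp
      _ ≤ 1 / Phi (-1) ^ 4 * (Real.log n * u ^ 4) := by gcongr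
      _ ≤ 1 / Phi (-1) ^ 4 * (Real.log n * u ^ 4 + 1 / n * u ^ 3) := by
        gcongr
        have : 0 ≤ 1 / n * u ^ 3 := by positivity
        linarith
      _ ≤ _ := by
        gcongr
        linarith

/-- Compare `(1-u)^m` with `exp(-mu)` and extend to a Gamma integral. -/
lemma integral_pow_mul_one_sub_pow_le (k : ℕ) {m : ℕ} (hm : 0 < m) :
    ∫ u in (0 : ℝ)..1, u ^ k * (1 - u) ^ m ≤ k.factorial / (m : ℝ) ^ (k + 1) := by
  have hm0 : (0 : ℝ) < m := by exact_mod_cast hm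
  have hk : (0 : ℝ) < (k : ℝ) + 1 := by positivity
  have hG := Real.integral_rpow_mul_exp_neg_mul_Ioi hk hm0
  have hi : IntegrableOn (fun t : ℝ => t ^ k * Real.exp (-(m * t))) (Set.Ioi 0) := by
    have : ∫ t in Set.Ioi (0 : ℝ), t ^ k * Real.exp (-(m * t)) ≠ 0 := by
      simp only [add_sub_cancel_right, Real.rpow_natCast] at hG
      rw [hG]
      have := Real.Gamma_pos_of_pos hk
      positivity
    exact Integrable.of_integral_ne_zero this
  have h1 : ∫ u in (0 : ℝ)..1, u ^ k * (1 - u) ^ m ≤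
      ∫ u in (0 : ℝ)..1, u ^ k * Real.exp (-(m * u)) := by
    refine intervalIntegral.integral_mono_on zero_le_one
      (Continuous.intervalIntegrable (by fun_prop) _ _)
      (Continuous.intervalIntegrable (by fun_prop) _ _) fun u hu => ?_
    have := hu.1
    have h3 : 0 ≤ 1 - u := by linarith [hu.2]
    gcongr
    calc (1 - u) ^ m ≤ Real.exp (-u) ^ m := by
          gcongr; exact Real.one_sub_le_exp_neg u
      _ = _ := by rw [← Real.exp_nat_mul]; ring_nf
  refine h1.trans ?_
  rw [intervalIntegral.integral_of_le zero_le_one]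
  refine (setIntegral_mono_set hi ?_ (Set.Ioc_subset_Ioi_self).eventuallyLE).trans ?_
  · filter_upwards [ae_restrict_mem measurableSet_Ioi] with t ht
    have : (0 : ℝ) < t := ht
    simp only [Pi.zero_apply]
    positivity
  · simp only [add_sub_cancel_right, Real.rpow_natCast, Real.Gamma_nat_eq_factorial] at hG
    rw [hG, ← Nat.cast_add_one, Real.rpow_natCast]
    rw [one_div, inv_pow, ← div_eq_inv_mul]

lemma integral_one_sub_pow (m : ℕ) (u : ℝ) :
    ∫ v in u..1, (1 - v) ^ m = (1 - u) ^ (m + 1) / (m + 1) := by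
  rw [intervalIntegral.integral_comp_sub_left (fun v : ℝ => v ^ m) 1, integral_pow]
  simp

section GOE

variable {Ω : Type*} [MeasurableSpace Ω] {μ : Measure Ω} [IsProbabilityMeasure μ] {m : ℕ}
  {Q : Ω → Matrix (Fin (m + 2)) (Fin (m + 2)) ℝ}

lemma IsGOE.integral_q_sq_le (hQ : IsGOE μ Q) (hm : 1 ≤ m) :
    ∫ ω, q Q ω ^ 2 ∂μ ≤ (128 + 1 / Phi (-1) ^ 4) * 864 *
      (Real.log (m + 2 : ℕ) / ((m + 2 : ℕ) : ℝ) ^ 4) := by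
  set C := 128 + 1 / Phi (-1) ^ 4 with hC
  have hC0 : 0 < C := by have := Phi_pos (-1); positivity
  have hmeas : Measurable fun u => Phi (√2 * PhiInv u) ^ 2 := by
    have := measurable_PhiInv
    have := measurable_Phi
    fun_prop
  have hb : ∀ u, |Phi (√2 * PhiInv u) ^ 2| ≤ 1 := fun u => by
    rw [abs_of_nonneg (sq_nonneg _)]
    exact pow_le_one₀ (Phi_pos _).le (Phi_lt_one _).le
  have h1 : ∫ ω, q Q ω ^ 2 ∂μ =
      (m + 2) * ∫ u in (0 : ℝ)..1, Phi (√2 * PhiInv u) ^ 2 * (1 - u) ^ (m + 1) := by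
    have := hQ.integral_U (h := fun u _ => Phi (√2 * PhiInv u) ^ 2)
      (hmeas.comp measurable_fst) fun u _ => hb u
    simp only [U, PhiInv_Phi, intervalIntegral.integral_mul_const, integral_one_sub_pow] at this
    simp only [q]
    rw [this, mul_assoc, ← intervalIntegral.integral_const_mul]
    congr 2
    funext u
    field_simp
  set n := m + 2 with hn
  have hn2 : ((n : ℕ) : ℝ) = m + 2 := by rw [hn]; push_cast; ring
  have h2 : ∫ u in (0 : ℝ)..1, Phi (√2 * PhiInv u) ^ 2 * (1 - u) ^ (m + 1) ≤
      ∫ u in (0 : ℝ)..1, C * (Real.log n * (u ^ 4 * (1 - u) ^ (m + 1)) +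
        1 / n * (u ^ 3 * (1 - u) ^ (m + 1))) := by
    refine intervalIntegral.integral_mono_on_of_le_Ioo zero_le_one ?_
      (Continuous.intervalIntegrable (by fun_prop) _ _) fun u hu => ?_
    · refine IntervalIntegrable.mul_continuousOn ?_ (by fun_prop)
      rw [intervalIntegrable_iff]
      exact Measure.integrableOn_of_bounded (M := 1) (by simp) hmeas.aestronglyMeasurable
        (Eventually.of_forall hb)
    · have := Phi_sqrt_two_PhiInv_sq_le hu (n := n) (by omega)
      have h3 : 0 ≤ (1 - u) ^ (m + 1) := pow_nonneg (by linarith [hu.2]) _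
      calc _ ≤ _ := mul_le_mul_of_nonneg_right this h3
        _ = _ := by ring
  have hlog := one_le_log_of_three_le (n := n) (by omega)
  have hn0 : (0 : ℝ) < n := by rw [hn2]; positivity
  have h4 := integral_pow_mul_one_sub_pow_le 4 (Nat.succ_pos m)
  have h3 := integral_pow_mul_one_sub_pow_le 3 (Nat.succ_pos m)
  -- The exponent is `m + 1 = n - 1 ≥ n/2`, which yields `768 = 4!·2⁵` and `96 = 3!·2⁴`; their sum
  -- is the final `864`, as `1 ≤ log n`.
  have hmn : (n : ℝ) / 2 ≤ (m + 1 : ℕ) := by rw [hn2]; push_cast; linarith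
  have h4' : ∫ u in (0 : ℝ)..1, u ^ 4 * (1 - u) ^ (m + 1) ≤ 768 / (n : ℝ) ^ 5 :=
    calc _ ≤ _ := h4
      _ ≤ (Nat.factorial 4 : ℕ) / ((n : ℝ) / 2) ^ 5 := by gcongr
      _ = _ := by simp [Nat.factorial]; field_simp; norm_num
  have h3' : ∫ u in (0 : ℝ)..1, u ^ 3 * (1 - u) ^ (m + 1) ≤ 96 / (n : ℝ) ^ 4 :=
    calc _ ≤ _ := h3
      _ ≤ (Nat.factorial 3 : ℕ) / ((n : ℝ) / 2) ^ 4 := by gcongr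
      _ = _ := by simp [Nat.factorial]; field_simp; norm_num
  rw [intervalIntegral.integral_const_mul, intervalIntegral.integral_add
    (Continuous.intervalIntegrable (by fun_prop) _ _)
    (Continuous.intervalIntegrable (by fun_prop) _ _), intervalIntegral.integral_const_mul,
    intervalIntegral.integral_const_mul] at h2
  rw [h1, ← hn2]
  calc (n : ℝ) * ∫ u in (0 : ℝ)..1, Phi (√2 * PhiInv u) ^ 2 * (1 - u) ^ (m + 1)
      ≤ n * (C * (Real.log n * (768 / (n : ℝ) ^ 5) + 1 / n * (96 / (n : ℝ) ^ 4))) := by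
        refine mul_le_mul_of_nonneg_left (h2.trans ?_) hn0.le
        gcongr
    _ = C * ((768 * Real.log n + 96) / (n : ℝ) ^ 4) := by field_simp
    _ ≤ C * ((864 * Real.log n) / (n : ℝ) ^ 4) := by gcongr; linarith
    _ = _ := by ring

lemma one_sub_prod_one_sub_le {ι : Type*} (s : Finset ι) {f : ι → ℝ}
    (h0 : ∀ i ∈ s, 0 ≤ f i) (h1 : ∀ i ∈ s, f i ≤ 1) :
    1 - ∏ i ∈ s, (1 - f i) ≤ ∑ i ∈ s, f i := by
  classical
  induction s using Finset.induction_on with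
  | empty => simp
  | insert a s ha ih =>
    have ih := ih (fun i hi => h0 i (Finset.mem_insert_of_mem hi))
      fun i hi => h1 i (Finset.mem_insert_of_mem hi)
    rw [Finset.prod_insert ha, Finset.sum_insert ha]
    have hp0 : 0 ≤ ∏ i ∈ s, (1 - f i) := Finset.prod_nonneg fun i hi => by
      linarith [h1 i (Finset.mem_insert_of_mem hi)]
    have hp1 : ∏ i ∈ s, (1 - f i) ≤ 1 := Finset.prod_le_one
      (fun i hi => by linarith [h1 i (Finset.mem_insert_of_mem hi)])
      (fun i hi => by linarith [h0 i (Finset.mem_insert_of_mem hi)])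
    nlinarith [h0 a (Finset.mem_insert_self a s)]

lemma sum_sub_sq_le_one_sub_prod {ι : Type*} (s : Finset ι) {f : ι → ℝ}
    (h0 : ∀ i ∈ s, 0 ≤ f i) (h1 : ∀ i ∈ s, f i ≤ 1) :
    ∑ i ∈ s, f i - (∑ i ∈ s, f i) ^ 2 ≤ 1 - ∏ i ∈ s, (1 - f i) := by
  have hS : 0 ≤ ∑ i ∈ s, f i := Finset.sum_nonneg h0
  have hp : ∏ i ∈ s, (1 - f i) ≤ Real.exp (-∑ i ∈ s, f i) := by
    rw [← Finset.sum_neg_distrib, Real.exp_sum]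
    exact Finset.prod_le_prod (fun i hi => by linarith [h1 i hi])
      fun i _ => Real.one_sub_le_exp_neg _
  -- After multiplication by `exp S ≥ 1 + S`, this is `(1 - S + S²)(1 + S) = 1 + S³ ≥ 1`.
  have he : Real.exp (-∑ i ∈ s, f i) ≤ 1 - ∑ i ∈ s, f i + (∑ i ∈ s, f i) ^ 2 := by
    set S := ∑ i ∈ s, f i
    rw [Real.exp_neg, inv_le_iff_one_le_mul₀ (Real.exp_pos _)]
    have : 0 ≤ 1 - S + S ^ 2 := by nlinarith [sq_nonneg (S - 1)]
    calc (1 : ℝ) ≤ (1 - S + S ^ 2) * (S + 1) := by nlinarith [pow_nonneg hS 3]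
      _ ≤ _ := by gcongr; exact Real.add_one_le_exp S
  linarith

/-- Two losses of at most `(nq)²` each: replacing the weight by `1` (Bernoulli's inequality, with `∑
f ≤ nq`) and replacing `1 - ∏(1 - f)` by `∑ f`. -/
lemma abs_pow_mul_one_sub_prod_sub_sum_le {n : ℕ} {f : ℕ → ℝ} {q : ℝ} (hq : q ≤ 1)
    (h0 : ∀ j ∈ Finset.Icc 3 n, 0 ≤ f j) (h1 : ∀ j ∈ Finset.Icc 3 n, f j ≤ q) (hq0 : 0 ≤ q) :
    |(1 - q) ^ (n - 1) * (1 - ∏ j ∈ Finset.Icc 3 n, (1 - f j)) - ∑ j ∈ Finset.Icc 3 n, f j| ≤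
      2 * (n : ℝ) ^ 2 * q ^ 2 := by
  have h1' : ∀ j ∈ Finset.Icc 3 n, f j ≤ 1 := fun j hj => (h1 j hj).trans hq
  have ha := one_sub_prod_one_sub_le _ h0 h1'
  have hb := sum_sub_sq_le_one_sub_prod _ h0 h1'
  have hS : 0 ≤ ∑ j ∈ Finset.Icc 3 n, f j := Finset.sum_nonneg h0
  have hSn : ∑ j ∈ Finset.Icc 3 n, f j ≤ n * q := by
    refine (Finset.sum_le_card_nsmul _ _ _ h1).trans ?_
    rw [nsmul_eq_mul]
    gcongr
    simp
  have hP0 : 0 ≤ 1 - ∏ j ∈ Finset.Icc 3 n, (1 - f j) := by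
    rw [sub_nonneg]
    exact Finset.prod_le_one (fun i hi => by linarith [h1' i hi])
      (fun i hi => by linarith [h0 i hi])
  set S := ∑ j ∈ Finset.Icc 3 n, f j
  set P := 1 - ∏ j ∈ Finset.Icc 3 n, (1 - f j)
  have hw1 : (1 - q) ^ (n - 1) ≤ 1 := pow_le_one₀ (by linarith) (by linarith)
  have hw2 : 1 - n * q ≤ (1 - q) ^ (n - 1) := by
    have := one_add_mul_le_pow (a := -q) (by linarith) (n - 1)
    have hc : ((n - 1 : ℕ) : ℝ) ≤ n := by exact_mod_cast Nat.sub_le n 1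
    rw [← sub_eq_add_neg] at this
    nlinarith
  set w := (1 - q) ^ (n - 1)
  have hn : (0 : ℝ) ≤ n * q := by positivity
  rw [abs_le]
  constructor
  · nlinarith [mul_le_mul_of_nonneg_right hw2 hP0, mul_le_mul hSn hSn hS hn,
      mul_le_mul_of_nonneg_left (ha.trans hSn) hn]
  · nlinarith [mul_le_mul_of_nonneg_right hw1 hP0, sq_nonneg (n * q)]

/-- The reduction of `A_n` to `I_n`. -/
theorem IsGOE.abs_A_sub_I_le (hQ : IsGOE μ Q) (hm : 1 ≤ m) :
    |A μ Q - I μ Q| ≤ 2 * ((128 + 1 / Phi (-1) ^ 4) * 864) *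
      (Real.log (m + 2 : ℕ) / ((m + 2 : ℕ) : ℝ) ^ 2) := by
  have hae : ∀ᵐ ω ∂μ, ∀ j ∈ Finset.Icc 3 (m + 2),
      p μ Q 2 j ω = Phi (√2 * tau (Q ω) 2 j) := by
    rw [Filter.eventually_all_finset]
    intro j hj
    rw [Finset.mem_Icc] at hj
    exact hQ.p_ae_eq (by omega) (by omega) hj.2
  have hA : A μ Q = ∫ ω, (1 - q Q ω) ^ (m + 2 - 1) *
      (1 - ∏ j ∈ Finset.Icc 3 (m + 2), (1 - Phi (√2 * tau (Q ω) 2 j))) ∂μ := by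
    refine integral_congr_ae ?_
    filter_upwards [hae] with ω hω
    rw [Finset.prod_congr rfl fun j hj => by rw [hω j hj]]
  have hmp : ∀ j, Measurable fun ω => Phi (√2 * tau (Q ω) 2 j) := fun j =>
    measurable_Phi.comp ((hQ.measurable_tau 2 j).const_mul _)
  have hqm := hQ.measurable_q
  have hq0 : ∀ ω, 0 ≤ q Q ω := fun ω => (Phi_pos _).le
  have hq1 : ∀ ω, q Q ω ≤ 1 := fun ω => (Phi_lt_one _).le
  have hbound : ∀ ω, |(1 - q Q ω) ^ (m + 2 - 1) *
      (1 - ∏ j ∈ Finset.Icc 3 (m + 2), (1 - Phi (√2 * tau (Q ω) 2 j))) -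
      ∑ j ∈ Finset.Icc 3 (m + 2), Phi (√2 * tau (Q ω) 2 j)| ≤
      2 * ((m + 2 : ℕ) : ℝ) ^ 2 * q Q ω ^ 2 := fun ω =>
    abs_pow_mul_one_sub_prod_sub_sum_le (hq1 ω) (fun j _ => (Phi_pos _).le)
      (fun j _ => strictMono_Phi.monotone (by
        unfold tau; gcongr; exact sub_le_self _ (Real.sqrt_nonneg _))) (hq0 ω)
  have hi1 : Integrable (fun ω => ∑ j ∈ Finset.Icc 3 (m + 2), Phi (√2 * tau (Q ω) 2 j)) μ :=
    integrable_finsetSum _ fun j _ => Integrable.of_bound (hmp j).aestronglyMeasurable 1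
      (Eventually.of_forall fun ω => by
        rw [Real.norm_of_nonneg (Phi_pos _).le]; exact (Phi_lt_one _).le)
  have hi2 : Integrable (fun ω => (1 - q Q ω) ^ (m + 2 - 1) *
      (1 - ∏ j ∈ Finset.Icc 3 (m + 2), (1 - Phi (√2 * tau (Q ω) 2 j)))) μ := by
    refine Integrable.of_bound (Measurable.aestronglyMeasurable ?_) 1
      (Eventually.of_forall fun ω => ?_)
    · refine ((hqm.const_sub 1).pow_const _).mul ((Finset.measurable_prod _ fun j _ =>
        (hmp j).const_sub 1).const_sub 1)
    · have h1 : 0 ≤ ∏ j ∈ Finset.Icc 3 (m + 2), (1 - Phi (√2 * tau (Q ω) 2 j)) :=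
        Finset.prod_nonneg fun j _ => by linarith [Phi_lt_one (√2 * tau (Q ω) 2 j)]
      have h2 : ∏ j ∈ Finset.Icc 3 (m + 2), (1 - Phi (√2 * tau (Q ω) 2 j)) ≤ 1 :=
        Finset.prod_le_one (fun j _ => by linarith [Phi_lt_one (√2 * tau (Q ω) 2 j)])
          fun j _ => by linarith [Phi_pos (√2 * tau (Q ω) 2 j)]
      have h3 : 0 ≤ 1 - q Q ω := by linarith [hq1 ω]
      rw [norm_mul, Real.norm_of_nonneg (pow_nonneg h3 _), Real.norm_of_nonneg (by linarith)]
      exact mul_le_one₀ (pow_le_one₀ h3 (by linarith [hq0 ω])) (by linarith) (by linarith)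
  have hi3 : Integrable (fun ω => 2 * ((m + 2 : ℕ) : ℝ) ^ 2 * q Q ω ^ 2) μ := by
    refine (Integrable.of_bound (hqm.pow_const 2).aestronglyMeasurable 1
      (Eventually.of_forall fun ω => ?_)).const_mul _
    rw [Real.norm_of_nonneg (sq_nonneg _)]
    exact pow_le_one₀ (hq0 ω) (hq1 ω)
  have hn0 : (0 : ℝ) < ((m + 2 : ℕ) : ℝ) := by positivity
  rw [← hQ.integral_sum_eq_I, hA, ← integral_sub hi2 hi1]
  refine (Real.norm_eq_abs _).symm.trans_le ?_
  calc _ ≤ ∫ ω, 2 * ((m + 2 : ℕ) : ℝ) ^ 2 * q Q ω ^ 2 ∂μ :=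
        norm_integral_le_of_norm_le hi3 (Eventually.of_forall hbound)
    _ = 2 * ((m + 2 : ℕ) : ℝ) ^ 2 * ∫ ω, q Q ω ^ 2 ∂μ := integral_const_mul _ _
    _ ≤ 2 * ((m + 2 : ℕ) : ℝ) ^ 2 * ((128 + 1 / Phi (-1) ^ 4) * 864 *
      (Real.log (m + 2 : ℕ) / ((m + 2 : ℕ) : ℝ) ^ 4)) := by
        gcongr; exact hQ.integral_q_sq_le hm
    _ = 2 * ((128 + 1 / Phi (-1) ^ 4) * 864) *
      (Real.log (m + 2 : ℕ) / ((m + 2 : ℕ) : ℝ) ^ 2) := by field_simp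

end GOE

/-! ### The pointwise and locally uniform limit of the layer integrand. -/

section Limits

variable {ι : Type*} {l : Filter ι}

/-- By Mills asymptotics the ratio of tails behaves like the ratio of densities, `exp(-2Sa - a²)`,
and the convergence of `S a` forces `a → 0`. -/
lemma tendsto_Phi_shift_ratio {S a : ι → ℝ} {c : ℝ} (hS : Tendsto S l atTop)
    (ha0 : ∀ᶠ i in l, 0 ≤ a i) (ha : Tendsto (fun i => S i * a i) l (𝓝 c)) :
    Tendsto (fun i => Phi (-(√2 * (S i + a i))) / Phi (-(√2 * S i))) l
      (𝓝 (Real.exp (-2 * c))) := by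
  have h2 : 0 < √2 := by positivity
  have hSa : Tendsto (fun i => S i + a i) l atTop :=
    tendsto_atTop_mono' l (ha0.mono fun i hi => by linarith) hS
  have hSinv : Tendsto (fun i => (S i)⁻¹) l (𝓝 0) := hS.inv_tendsto_atTop
  have ha' : Tendsto a l (𝓝 0) := by
    have := ha.mul hSinv
    rw [mul_zero] at this
    refine this.congr' ?_
    filter_upwards [hS.eventually_gt_atTop 0] with i hi
    field_simp
  have hm : Tendsto (fun r => √2 * r) atTop atTop := tendsto_id.const_mul_atTop h2
  have h3 := tendsto_mul_Phi_neg_div_phi.comp (hm.comp hSa)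
  have h4 := tendsto_mul_Phi_neg_div_phi.comp (hm.comp hS)
  have h5 : Tendsto (fun i => 1 + (S i)⁻¹ * a i) l (𝓝 1) := by
    simpa using (hSinv.mul ha').const_add 1
  have h6 : Tendsto (fun i => Real.exp (-2 * (S i * a i) - a i ^ 2)) l
      (𝓝 (Real.exp (-2 * c))) := by
    have := ((ha.const_mul (-2)).sub (ha'.pow 2)).rexp
    simpa using this
  have h7 := ((h3.div h4 one_ne_zero).div h5 one_ne_zero).mul h6
  simp only [div_one, one_mul] at h7
  refine h7.congr' ?_
  filter_upwards [hS.eventually_gt_atTop 0, ha0] with i hi hai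
  have hsa : 0 < S i + a i := by linarith
  have hphi : phi (√2 * (S i + a i)) =
      Real.exp (-2 * (S i * a i) - a i ^ 2) * phi (√2 * S i) := by
    rw [mul_add, phi_add]
    congr 2
    have : √2 * √2 = 2 := Real.mul_self_sqrt zero_le_two
    linear_combination (-(S i * a i) - a i ^ 2 / 2) * this
  have hp1 := phi_pos (√2 * S i)
  have hP1 := Phi_pos (-(√2 * S i))
  have he := Real.exp_pos (-2 * (S i * a i) - a i ^ 2)
  simp only [Function.comp_apply, Pi.div_apply, hphi]
  have : 1 + (S i)⁻¹ * a i ≠ 0 := by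
    have : 0 ≤ (S i)⁻¹ * a i := by positivity
    linarith
  field_simp

lemma tendsto_one_sub_pow_exp {N : ι → ℕ} {v : ι → ℝ} {x : ℝ} (hv : Tendsto v l (𝓝 0))
    (hNv : Tendsto (fun i => ((N i - 2 : ℕ) : ℝ) * v i) l (𝓝 x)) :
    Tendsto (fun i => (1 - v i) ^ (N i - 2)) l (𝓝 (Real.exp (-x))) := by
  have h1 : Tendsto (fun i => 1 - v i) l (𝓝 1) := by simpa using hv.const_sub 1
  have hlow : Tendsto (fun i => Real.exp (-(((N i - 2 : ℕ) : ℝ) * v i / (1 - v i)))) l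
      (𝓝 (Real.exp (-x))) := by
    have := (hNv.div h1 one_ne_zero).neg.rexp
    simpa using this
  refine tendsto_of_tendsto_of_tendsto_of_le_of_le' hlow hNv.neg.rexp ?_ ?_
  · filter_upwards [h1.eventually (lt_mem_nhds zero_lt_one)] with i hi
    have := Real.one_sub_inv_le_log_of_pos hi
    have h2 : 1 - (1 - v i)⁻¹ = -(v i / (1 - v i)) := by field_simp; ring
    rw [h2, Real.le_log_iff_exp_le hi] at this
    calc _ = Real.exp (-(v i / (1 - v i))) ^ (N i - 2) := by
          rw [← Real.exp_nat_mul]; ring_nf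
      _ ≤ _ := by gcongr
  · filter_upwards [h1.eventually (lt_mem_nhds zero_lt_one)] with i hi
    calc (1 - v i) ^ (N i - 2) ≤ Real.exp (-v i) ^ (N i - 2) := by
          gcongr; exact Real.one_sub_le_exp_neg _
      _ = _ := by rw [← Real.exp_nat_mul]; ring_nf

/-- The quantile gap: if `Φ(-T) = Φ(-S) (1 + β/S²)` then `S³ (S - T) → lim β`. -/
lemma tendsto_quantile_gap {S T β : ι → ℝ} {β₀ : ℝ} (hS : Tendsto S l atTop)
    (hβ : Tendsto β l (𝓝 β₀)) (hβ0 : ∀ᶠ i in l, 0 ≤ β i)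
    (hT : ∀ᶠ i in l, Phi (-T i) = Phi (-S i) * (1 + β i / S i ^ 2)) :
    Tendsto (fun i => S i ^ 3 * (S i - T i)) l (𝓝 β₀) ∧ ∀ᶠ i in l, T i ≤ S i := by
  have hS2 : Tendsto (fun i => (S i ^ 2)⁻¹) l (𝓝 0) :=
    ((tendsto_pow_atTop two_ne_zero).comp hS).inv_tendsto_atTop
  have hy : Tendsto (fun i => 1 + β i / S i ^ 2) l (𝓝 1) := by
    simpa [div_eq_mul_inv] using (hβ.mul hS2).const_add 1
  have hTS : ∀ᶠ i in l, T i ≤ S i := by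
    filter_upwards [hT, hβ0] with i hi hβi
    have : Phi (-S i) ≤ Phi (-T i) := by
      rw [hi]
      have : 0 ≤ β i / S i ^ 2 := by positivity
      nlinarith [Phi_pos (-S i)]
    linarith [strictMono_Phi.le_iff_le.1 this]
  have hTtop : Tendsto T l atTop := by
    have h1 : Tendsto (fun i => Phi (-T i)) l (𝓝[>] 0) := by
      rw [tendsto_nhdsWithin_iff]
      refine ⟨?_, Eventually.of_forall fun i => Phi_pos _⟩
      have := (tendsto_Phi_neg_atTop.comp hS).mul hy
      rw [zero_mul] at this
      exact this.congr' (hT.mono fun i hi => hi.symm)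
    have h2 := tendsto_PhiInv_zero.comp h1
    simp only [Function.comp_def, PhiInv_Phi] at h2
    simpa [Function.comp_def] using tendsto_neg_atBot_atTop.comp h2
  have hlog : ∀ᶠ i in l, Real.log (Phi (-T i)) - Real.log (Phi (-S i)) =
      Real.log (1 + β i / S i ^ 2) := by
    filter_upwards [hT, hβ0] with i hi hβi
    have : 0 ≤ β i / S i ^ 2 := by positivity
    rw [hi, Real.log_mul (Phi_pos _).ne' (by positivity)]
    ring
  have hTinv : Tendsto (fun i => (T i)⁻¹) l (𝓝 0) := hTtop.inv_tendsto_atTop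
  have hgap : Tendsto (fun i => S i - T i) l (𝓝 0) := by
    have h1 := (hy.log one_ne_zero).mul hTinv
    rw [Real.log_one, zero_mul] at h1
    refine squeeze_zero' (hTS.mono fun i hi => by linarith) ?_ h1
    filter_upwards [hTS, hlog, hTtop.eventually_gt_atTop 0] with i h1 h2 h3
    rw [← div_eq_mul_inv, le_div_iff₀ h3, mul_comm, ← h2]
    exact mul_sub_le_log_sub h3 h1
  have hST : Tendsto (fun i => S i / T i) l (𝓝 1) := by
    have := (hgap.mul hTinv).const_add 1
    rw [zero_mul, add_zero] at this
    refine this.congr' ?_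
    filter_upwards [hTtop.eventually_gt_atTop 0] with i h3
    field_simp
    ring
  -- The two sequences squeezing `S³(S - T)`. On `[T, S]` the hazard rate lies between `T` and `S +
  -- 1/T`, and `log y`, for `y = 1 + β/S²`, lies between `1 - 1/y` and `y - 1`.
  have hup : Tendsto (fun i => S i / T i * β i) l (𝓝 β₀) := by simpa using hST.mul hβ
  have hlow : Tendsto (fun i => β i / (1 + β i / S i ^ 2) / (1 + (S i)⁻¹ * (T i)⁻¹)) l (𝓝 β₀) := by
    have := (hβ.div hy one_ne_zero).div
      ((hS.inv_tendsto_atTop.mul hTinv).const_add 1) (by norm_num)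
    simpa [Pi.div_def] using this
  refine ⟨tendsto_of_tendsto_of_tendsto_of_le_of_le' hlow hup ?_ ?_, hTS⟩
  · filter_upwards [hTS, hlog, hTtop.eventually_gt_atTop 0, hS.eventually_gt_atTop 0, hβ0]
      with i h1 h2 h3 h4 h5
    have h6 := log_sub_le_mul_sub h3 h1
    have h7 := Real.one_sub_inv_le_log_of_pos (x := 1 + β i / S i ^ 2) (by positivity)
    rw [h2] at h6
    have h8 := h7.trans h6
    rw [div_le_iff₀ (by positivity), div_le_iff₀ (by positivity)]
    have h9 : 1 - (1 + β i / S i ^ 2)⁻¹ = β i / S i ^ 2 / (1 + β i / S i ^ 2) := by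
      field_simp; ring
    rw [h9, div_le_iff₀ (by positivity), div_le_iff₀ (by positivity)] at h8
    refine h8.trans (le_of_eq ?_)
    field_simp
  · filter_upwards [hTS, hlog, hTtop.eventually_gt_atTop 0, hS.eventually_gt_atTop 0, hβ0]
      with i h1 h2 h3 h4 h5
    have h6 := mul_sub_le_log_sub h3 h1
    have h7 := Real.log_le_sub_one_of_pos (x := 1 + β i / S i ^ 2) (by positivity)
    rw [h2] at h6
    have h8 := h6.trans h7
    rw [add_sub_cancel_left, le_div_iff₀ (by positivity)] at h8
    calc S i ^ 3 * (S i - T i) = S i / T i * (T i * (S i - T i) * S i ^ 2) := by field_simp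
      _ ≤ _ := by gcongr

lemma pairProb_le (u v w : ℝ) : pairProb u v w ≤ Phi (√2 * PhiInv u) := by
  apply strictMono_Phi.monotone
  gcongr
  exact sub_le_self _ (Real.sqrt_nonneg _)

/-- For fixed `w` the integrand ratio converges by `tendsto_Phi_shift_ratio`, and it never exceeds
`1`. Dominated convergence is run on the fixed interval `[0,1]`; the piece `[0, v]` is negligible
because `v → 0`. -/
lemma tendsto_G_ratio [l.IsCountablyGenerated] {u v S β : ι → ℝ} {β₀ : ℝ}
    (hS : Tendsto S l atTop) (hβ : Tendsto β l (𝓝 β₀)) (hβ0 : ∀ᶠ i in l, 0 ≤ β i)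
    (hu : ∀ i, S i = -PhiInv (u i)) (hv : Tendsto v l (𝓝 0))
    (hv0 : ∀ᶠ i in l, 0 < v i) (huv : ∀ᶠ i in l, v i = Phi (-S i) * (1 + β i / S i ^ 2)) :
    Tendsto (fun i => G (u i) (v i) / Phi (-(√2 * S i))) l (𝓝 (Real.exp (-2 * √β₀))) := by
  have hv1 : ∀ᶠ i in l, v i < 1 := hv.eventually (gt_mem_nhds zero_lt_one)
  have hT : ∀ᶠ i in l, Phi (-(-PhiInv (v i))) = Phi (-S i) * (1 + β i / S i ^ 2) := by
    filter_upwards [hv0, hv1, huv] with i h0 h1 h2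
    rw [neg_neg, Phi_PhiInv ⟨h0, h1⟩, h2]
  obtain ⟨hgap, hTS⟩ := tendsto_quantile_gap hS hβ hβ0 hT
  have hle : ∀ i w, pairProb (u i) (v i) w / Phi (-(√2 * S i)) ≤ 1 := fun i w => by
    rw [div_le_one (Phi_pos _), hu, mul_neg, neg_neg]
    exact pairProb_le _ _ _
  have hnn : ∀ i w, 0 ≤ pairProb (u i) (v i) w / Phi (-(√2 * S i)) := fun i w =>
    div_nonneg (pairProb_pos _ _ _).le (Phi_pos _).le
  have hpt : ∀ w, Tendsto (fun i => pairProb (u i) (v i) w / Phi (-(√2 * S i))) l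
      (𝓝 (Real.exp (-2 * √β₀))) := by
    intro w
    -- The square of the left side is `S²(S - T)(Φ⁻¹(w) + S) = S³(S - T)(1 + Φ⁻¹(w)/S)`, so only the
    -- quantile gap matters.
    have ha : Tendsto (fun i => S i * √((PhiInv (v i) - PhiInv (u i)) * (PhiInv w - PhiInv (u i))))
        l (𝓝 √β₀) := by
      have h1 : Tendsto (fun i => S i ^ 3 * (S i - -PhiInv (v i)) * (1 + PhiInv w * (S i)⁻¹)) l
          (𝓝 β₀) := by
        have := hgap.mul ((hS.inv_tendsto_atTop.const_mul (PhiInv w)).const_add 1)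
        simpa using this
      refine h1.sqrt.congr' ?_
      filter_upwards [hS.eventually_gt_atTop 0] with i hi
      have : S i ^ 3 * (S i - -PhiInv (v i)) * (1 + PhiInv w * (S i)⁻¹) =
          S i ^ 2 * ((PhiInv (v i) - PhiInv (u i)) * (PhiInv w - PhiInv (u i))) := by
        have : PhiInv (u i) = -S i := by rw [hu, neg_neg]
        rw [this]
        field_simp
        ring
      rw [this, Real.sqrt_mul (sq_nonneg _), Real.sqrt_sq hi.le]
    refine (tendsto_Phi_shift_ratio hS (Eventually.of_forall fun i => Real.sqrt_nonneg _)
      ha).congr fun i => ?_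
    rw [pairProb, hu i]
    congr 2
    ring
  have hint : Tendsto (fun i => ∫ w in (0 : ℝ)..1, pairProb (u i) (v i) w / Phi (-(√2 * S i))) l
      (𝓝 (∫ _w in (0 : ℝ)..1, Real.exp (-2 * √β₀))) := by
    refine intervalIntegral.tendsto_integral_filter_of_dominated_convergence (fun _ => 1)
      (Eventually.of_forall fun i =>
        ((measurable_pairProb_right _ _).div_const _).aestronglyMeasurable)
      (Eventually.of_forall fun i => Eventually.of_forall fun w _ => ?_) (by simp)
      (Eventually.of_forall fun w _ => hpt w)
    rw [Real.norm_of_nonneg (hnn i w)]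
    exact hle i w
  have hsmall : Tendsto (fun i => ∫ w in (0 : ℝ)..v i, pairProb (u i) (v i) w / Phi (-(√2 * S i)))
      l (𝓝 0) := by
    refine squeeze_zero_norm (fun i => ?_) (by simpa using hv.norm)
    have := intervalIntegral.norm_integral_le_of_norm_le_const (a := 0) (b := v i) (C := 1)
      (f := fun w => pairProb (u i) (v i) w / Phi (-(√2 * S i)))
      fun w _ => by rw [Real.norm_of_nonneg (hnn i w)]; exact hle i w
    simpa using this
  have h := ((hint.sub hsmall).div (hv.const_sub 1) (by norm_num))
  simp only [intervalIntegral.integral_const, sub_zero, one_smul, div_one] at h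
  refine h.congr' ?_
  filter_upwards [hv1] with i h1
  simp only [Pi.div_apply, intervalIntegral.integral_div]
  rw [← sub_div, intervalIntegral.integral_interval_sub_left
    (intervalIntegrable_pairProb _ _ _ _) (intervalIntegrable_pairProb _ _ _ _), G]
  ring

/-- The limit of the layer integrand along an arbitrary filter. -/
theorem tendsto_layerIntegrand [l.IsCountablyGenerated] {N : ι → ℕ} {x β : ι → ℝ} {x₀ β₀ : ℝ}
    (hN : Tendsto N l atTop) (hx : Tendsto x l (𝓝 x₀)) (hx₀ : 0 < x₀)
    (hβ : Tendsto β l (𝓝 β₀)) (hβ0 : ∀ᶠ i in l, 0 ≤ β i) :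
    Tendsto (fun i => layerIntegrand (N i) (x i) (β i)) l
      (𝓝 (√(Real.pi / 2) * x₀ ^ 3 * Real.exp (-x₀) * Real.exp (-2 * √β₀))) := by
  have hNr : Tendsto (fun i => (N i : ℝ)) l atTop := tendsto_natCast_atTop_atTop.comp hN
  have hNinv : Tendsto (fun i => (N i : ℝ)⁻¹) l (𝓝 0) := hNr.inv_tendsto_atTop
  have hxpos : ∀ᶠ i in l, 0 < x i := hx.eventually (lt_mem_nhds hx₀)
  have hu0 : Tendsto (fun i => x i / N i) l (𝓝 0) := by
    simpa [div_eq_mul_inv] using hx.mul hNinv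
  have hupos : ∀ᶠ i in l, 0 < x i / N i := by
    filter_upwards [hxpos, hNr.eventually_gt_atTop 0] with i h1 h2 using div_pos h1 h2
  have hu1 : ∀ᶠ i in l, x i / N i < 1 := hu0.eventually (gt_mem_nhds zero_lt_one)
  set S : ι → ℝ := fun i => s (N i) (x i) with hSdef
  have hPhiS : ∀ᶠ i in l, Phi (-S i) = x i / N i := by
    filter_upwards [hupos, hu1] with i h0 h1
    simp only [hSdef, s, neg_neg]
    exact Phi_PhiInv ⟨h0, h1⟩
  have hS : Tendsto S l atTop := tendsto_neg_atBot_atTop.comp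
    (tendsto_PhiInv_zero.comp (tendsto_nhdsWithin_iff.2 ⟨hu0, hupos⟩))
  have hS2 : Tendsto (fun i => (S i ^ 2)⁻¹) l (𝓝 0) :=
    ((tendsto_pow_atTop two_ne_zero).comp hS).inv_tendsto_atTop
  have hlogN : Tendsto (fun i => Real.log (N i) / S i ^ 2) l (𝓝 (1 / 2)) := by
    -- Here `log n = log(1/Phi(-S)) + log x`, and `log x` stays bounded.
    have h1 := (tendsto_log_inv_Phi_neg_div_sq.comp hS).add ((hx.log hx₀.ne').mul hS2)
    rw [mul_zero, add_zero] at h1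
    refine h1.congr' ?_
    filter_upwards [hPhiS, hxpos, hNr.eventually_gt_atTop 0] with i h1 h2 h3
    simp only [Function.comp_apply]
    rw [h1, one_div, Real.log_inv, Real.log_div h2.ne' h3.ne']
    ring
  have hsqrt : Tendsto (fun i => √(Real.log (N i)) / S i) l (𝓝 √(1 / 2)) := by
    refine hlogN.sqrt.congr' ?_
    filter_upwards [hS.eventually_gt_atTop 0] with i hi
    rw [Real.sqrt_div' _ (sq_nonneg _), Real.sqrt_sq hi.le]
  have hy : Tendsto (fun i => 1 + β i / S i ^ 2) l (𝓝 1) := by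
    simpa [div_eq_mul_inv] using (hβ.mul hS2).const_add 1
  set v : ι → ℝ := fun i => x i * (1 + β i / S i ^ 2) / N i with hvdef
  have hv : Tendsto v l (𝓝 0) := by
    simpa [hvdef, div_eq_mul_inv] using (hx.mul hy).mul hNinv
  have hv0 : ∀ᶠ i in l, 0 < v i := by
    filter_upwards [hxpos, hNr.eventually_gt_atTop 0, hβ0] with i h1 h2 h3
    have : 0 ≤ β i / S i ^ 2 := by positivity
    simp only [hvdef]
    positivity
  have hG := tendsto_G_ratio (u := fun i => x i / N i) hS hβ hβ0 (fun i => rfl) hv hv0 (by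
    filter_upwards [hPhiS] with i h1
    rw [h1]; simp only [hvdef]; ring)
  have hN2 : ∀ᶠ i in l, ((N i - 2 : ℕ) : ℝ) = N i - 2 := by
    filter_upwards [hN.eventually_ge_atTop 2] with i hi
    push_cast [hi]; ring
  have hpow : Tendsto (fun i => (1 - v i) ^ (N i - 2)) l (𝓝 (Real.exp (-x₀))) := by
    refine tendsto_one_sub_pow_exp hv ?_
    have := (hx.mul hy).sub (hv.const_mul 2)
    rw [mul_one, mul_zero, sub_zero] at this
    refine this.congr' ?_
    filter_upwards [hN2, hNr.eventually_gt_atTop 0] with i h1 h2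
    rw [h1]
    simp only [hvdef]
    field_simp
  have hcoef : Tendsto (fun i => (1 - (N i : ℝ)⁻¹) * (1 - 2 * (N i : ℝ)⁻¹)) l (𝓝 1) := by
    simpa using (hNinv.const_sub 1).mul ((hNinv.const_mul 2).const_sub 1)
  have hratio := tendsto_Phi_sqrt_two_ratio.comp hS
  -- The integrand is exactly `(√(log n)/S) · (1-1/n)(1-2/n) · Φ(-√2 S)/(u² S) · x³ · (1-v)^(n-2) ·
  -- G/Φ(-√2 S)`, and each factor has a limit.
  have h := ((((hsqrt.mul hcoef).mul hratio).mul (hx.pow 3)).mul hpow).mul hG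
  have hval : √(1 / 2) * 1 * √Real.pi = √(Real.pi / 2) := by
    rw [mul_one, mul_comm, ← Real.sqrt_mul Real.pi_pos.le]
    congr 1; ring
  rw [hval] at h
  refine h.congr' ?_
  filter_upwards [hPhiS, hxpos, hNr.eventually_gt_atTop 0, hS.eventually_gt_atTop 0]
    with i h1 h2 h3 h4
  have h5 := (Phi_pos (-(√2 * S i))).ne'
  simp only [Function.comp_apply, layerIntegrand, h1]
  change _ = N i * √(Real.log (N i)) * ((N i - 1) * (N i - 2) / N i) * (1 - v i) ^ (N i - 2) *
    G (x i / N i) (v i) * (x i / S i ^ 2)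
  generalize Phi (-(√2 * S i)) = P at h5 ⊢
  field_simp

end Limits

/-- On a compact set, uniform convergence follows from joint convergence along `atTop ×ˢ 𝓝[K] z₀` at
each point `z₀`, the limit being continuous. This is why `tendsto_layerIntegrand` allows `N`, `x`
and `β` to vary along an arbitrary filter. -/
theorem tendstoUniformlyOn_layerIntegrand {δ : ℝ} (M B : ℝ) (hδ : 0 < δ) :
    TendstoUniformlyOn (fun (n : ℕ) (z : ℝ × ℝ) => layerIntegrand n z.1 z.2)
      (fun z => √(Real.pi / 2) * z.1 ^ 3 * Real.exp (-z.1) * Real.exp (-2 * √z.2))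
      atTop (Set.Icc δ M ×ˢ Set.Icc 0 B) := by
  rw [← tendstoLocallyUniformlyOn_iff_tendstoUniformlyOn_of_compact
    (isCompact_Icc.prod isCompact_Icc), tendstoLocallyUniformlyOn_iff_forall_tendsto]
  rintro ⟨x₀, β₀⟩ ⟨hx₀, -⟩
  have hz : Tendsto (fun y : ℕ × ℝ × ℝ => y.2)
      (atTop ×ˢ 𝓝[Set.Icc δ M ×ˢ Set.Icc 0 B] (x₀, β₀)) (𝓝 (x₀, β₀)) :=
    tendsto_nhds_of_tendsto_nhdsWithin tendsto_snd
  have hmem : ∀ᶠ y : ℕ × ℝ × ℝ in atTop ×ˢ 𝓝[Set.Icc δ M ×ˢ Set.Icc 0 B] (x₀, β₀),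
      y.2 ∈ Set.Icc δ M ×ˢ Set.Icc 0 B :=
    tendsto_snd.eventually self_mem_nhdsWithin
  have h1 := tendsto_layerIntegrand (N := fun y : ℕ × ℝ × ℝ => y.1) tendsto_fst
    ((continuous_fst.tendsto (x₀, β₀)).comp hz) (hδ.trans_le hx₀.1)
    ((continuous_snd.tendsto (x₀, β₀)).comp hz) (hmem.mono fun y hy => hy.2.1)
  have hcont : Continuous fun z : ℝ × ℝ =>
      √(Real.pi / 2) * z.1 ^ 3 * Real.exp (-z.1) * Real.exp (-2 * √z.2) := by fun_prop
  have h2 := (hcont.tendsto (x₀, β₀)).comp hz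
  exact (h2.prodMk_nhds h1).mono_right (nhds_le_uniformity _)

/-! ### A majorant for the layer integrand, independent of `n`. -/

section Domination

lemma pairProb_anti_right {u v w w' : ℝ} (huv : PhiInv u ≤ PhiInv v) (hw : 0 < w) (hww : w ≤ w')
    (hw' : w' < 1) : pairProb u v w' ≤ pairProb u v w := by
  apply strictMono_Phi.monotone
  have := PhiInv_le_PhiInv hw hw' hww
  have : 0 ≤ PhiInv v - PhiInv u := by linarith
  gcongr

lemma G_eq_integral_unit {u v : ℝ} (hv : v < 1) :
    G u v = ∫ r in (0 : ℝ)..1, pairProb u v (v + (1 - v) * r) := by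
  have : 1 - v ≠ 0 := by linarith
  rw [intervalIntegral.integral_comp_add_mul (fun w => pairProb u v w) this, G, smul_eq_mul]
  simp

/-- Rescaling `[v,1]` to `[0,1]` sends `r` to `v + (1-v)r ≥ r`, and the pair probability decreases
in its last argument. The prefactor `1/(1-v)`, unbounded near `v = 1`, disappears. -/
lemma G_le_integral_unit {u v : ℝ} (hu : 0 < u) (huv : u ≤ v) (hv : v < 1) :
    G u v ≤ ∫ r in (0 : ℝ)..1, pairProb u v r := by
  rw [G_eq_integral_unit hv]
  refine intervalIntegral.integral_mono_on_of_le_Ioo zero_le_one ?_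
    (intervalIntegrable_pairProb _ _ _ _) fun r hr => ?_
  · rw [intervalIntegrable_iff]
    exact Measure.integrableOn_of_bounded (f := fun r => pairProb u v (v + (1 - v) * r))
      (M := 1) (by simp)
      ((measurable_pairProb_right u v).comp (by fun_prop)).aestronglyMeasurable
      (Eventually.of_forall fun w => abs_pairProb_le_one u v _)
  · refine pairProb_anti_right (PhiInv_le_PhiInv hu hv huv) hr.1 ?_ ?_
    · nlinarith [hr.2]
    · nlinarith [hr.2]

lemma min_half_le_log_one_add {y : ℝ} (hy : 0 ≤ y) : min y 1 / 2 ≤ Real.log (1 + y) := by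
  have h1 := Real.one_sub_inv_le_log_of_pos (x := 1 + y) (by linarith)
  refine le_trans ?_ h1
  have h2 : 1 - (1 + y)⁻¹ = y / (1 + y) := by field_simp; ring
  rw [h2, div_le_div_iff₀ (by norm_num) (by linarith)]
  rcases le_total y 1 with h | h
  · rw [min_eq_left h]; nlinarith
  · rw [min_eq_right h]; linarith

/-- Quantile gap bound valid for all `β ≥ 0`. If `T ≥ 1`, the hazard rate on `[T, S]` is at most
`2S`, and `log(1+y) ≥ min y 1 / 2`; the cap at `S` reflects that minimum. If `T < 1`, the gap
exceeds `1` anyway. -/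
lemma sq_min_le_quantile_gap {S T β : ℝ} (hS : 4 ≤ S) (hβ : 0 ≤ β)
    (hT : Phi (-T) = Phi (-S) * (1 + β / S ^ 2)) :
    min (√β) S ^ 2 ≤ 8 * S ^ 3 * (S - T) := by
  have hS0 : 0 < S := by linarith
  have hy : 0 ≤ β / S ^ 2 := by positivity
  have hmin0 : 0 ≤ min (√β) S := le_min (Real.sqrt_nonneg _) hS0.le
  rcases le_or_gt 1 T with h1 | h1
  · have hTS : T ≤ S := by
      have : Phi (-S) ≤ Phi (-T) := by
        rw [hT]; nlinarith [Phi_pos (-S)]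
      linarith [strictMono_Phi.le_iff_le.1 this]
    have h2 := log_sub_le_mul_sub (by linarith) hTS
    have h3 : Real.log (Phi (-T)) - Real.log (Phi (-S)) = Real.log (1 + β / S ^ 2) := by
      rw [hT, Real.log_mul (Phi_pos _).ne' (by positivity)]; ring
    have h4 : 1 / T ≤ 1 := by rw [div_le_one (by linarith)]; exact h1
    have h5 : min (β / S ^ 2) 1 / 2 ≤ 2 * S * (S - T) := by
      refine (min_half_le_log_one_add hy).trans ?_
      rw [← h3]
      refine h2.trans (mul_le_mul_of_nonneg_right ?_ (by linarith))
      linarith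
    have h6 : min (√β) S ^ 2 ≤ S ^ 2 * min (β / S ^ 2) 1 := by
      rw [mul_min_of_nonneg _ _ (sq_nonneg S), mul_one, mul_div_cancel₀ _ (by positivity)]
      refine le_min ?_ ?_
      · calc min (√β) S ^ 2 ≤ √β ^ 2 := by gcongr; exact min_le_left _ _
          _ = β := Real.sq_sqrt hβ
      · gcongr; exact min_le_right _ _
    nlinarith [mul_le_mul_of_nonneg_left h5 (sq_nonneg S), sq_nonneg (min (√β) S)]
  · have h2 : min (√β) S ^ 2 ≤ S ^ 2 := by gcongr; exact min_le_right _ _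
    have h3 : 1 ≤ S - T := by linarith
    calc _ ≤ S ^ 2 := h2
      _ ≤ 8 * S ^ 3 * 1 := by nlinarith [sq_nonneg S]
      _ ≤ _ := by gcongr

/-- The exponential bound on `G` away from the diagonal. -/
theorem G_le_exp {u S β : ℝ} (hu : u ∈ Set.Ioo (0 : ℝ) 1) (hSu : S = -PhiInv u) (hS : 4 ≤ S)
    (hβ : 0 ≤ β) (hv : u * (1 + β / S ^ 2) < 1) :
    G u (u * (1 + β / S ^ 2)) ≤ 2 * Phi (-(√2 * S)) * Real.exp (-(min (√β) S / 2)) := by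
  set v := u * (1 + β / S ^ 2) with hvdef
  have hS0 : 0 < S := by linarith
  have hy : 0 ≤ β / S ^ 2 := by positivity
  have hu0 := hu.1
  have huv : u ≤ v := by rw [hvdef]; nlinarith
  have hPu : PhiInv u = -S := by linarith
  have huS : Phi (-S) = u := by rw [← hPu, Phi_PhiInv hu]
  have hgap := sq_min_le_quantile_gap (T := -PhiInv v) hS hβ (by
    rw [neg_neg, Phi_PhiInv ⟨hu0.trans_le huv, hv⟩, huS])
  have hPuv := PhiInv_le_PhiInv hu0 hv huv
  have hP := Phi_pos (-(√2 * S))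
  have hm0 : 0 ≤ min (√β) S := le_min (Real.sqrt_nonneg _) hS0.le
  have h1 : ∀ r, pairProb u v r ≤ Phi (-(√2 * S)) := fun r => by
    have := pairProb_le u v r
    rwa [hPu, mul_neg] at this
  -- Cut `[0,1]` at `Phi(-S/2)`. Above the cut `Φ⁻¹(r) + S ≥ S/2`, so the shift `a` satisfies `4 S a
  -- ≥ min √β S`. Below it the length of the interval is already small.
  have h2 : ∀ r ∈ Set.Ioo (Phi (-(S / 2))) 1,
      pairProb u v r ≤ Phi (-(√2 * S)) * Real.exp (-(min (√β) S / 2)) := by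
    intro r hr
    have hr' : -(S / 2) ≤ PhiInv r := by
      rw [← strictMono_Phi.le_iff_le, Phi_PhiInv ⟨(Phi_pos _).trans hr.1, hr.2⟩]
      exact hr.1.le
    set a := √((PhiInv v - PhiInv u) * (PhiInv r - PhiInv u)) with ha
    have ha0 : 0 ≤ a := Real.sqrt_nonneg _
    have hSa : min (√β) S ≤ 4 * S * a := by
      have : (4 * S * a) ^ 2 = 16 * S ^ 2 * ((S - -PhiInv v) * (PhiInv r + S)) := by
        rw [mul_pow, ha, Real.sq_sqrt (mul_nonneg (by linarith) (by linarith)), hPu]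
        ring
      refine le_of_sq_le_sq ?_ (by positivity)
      rw [this]
      refine hgap.trans ?_
      have h3 : S / 2 ≤ PhiInv r + S := by linarith
      have h4 : 0 ≤ S - -PhiInv v := by linarith
      calc 8 * S ^ 3 * (S - -PhiInv v) = 16 * S ^ 2 * ((S - -PhiInv v) * (S / 2)) := by ring
        _ ≤ _ := by gcongr
    have h5 := Phi_neg_add_le (√2 * S) (b := √2 * a) (by positivity)
    have h6 : pairProb u v r = Phi (-(√2 * S + √2 * a)) := by
      rw [pairProb, ← ha, hPu]; congr 1; ring
    rw [h6]
    refine h5.trans ?_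
    rw [mul_comm]
    refine mul_le_mul_of_nonneg_left (Real.exp_le_exp.2 ?_) hP.le
    have h7 : √2 * √2 = 2 := Real.mul_self_sqrt zero_le_two
    have h8 : -(√2 * S) * (√2 * a) = -(2 * S * a) := by linear_combination (-(S * a)) * h7
    rw [h8]
    nlinarith [sq_nonneg (√2 * a)]
  -- `exp(-S²/8) ≤ exp(-S/2)` is where `4 ≤ S` is needed.
  have hr0 : Phi (-(S / 2)) ≤ Real.exp (-(min (√β) S / 2)) := by
    refine (Phi_neg_le_exp (by positivity)).trans (Real.exp_le_exp.2 ?_)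
    have : min (√β) S ≤ S := min_le_right _ _
    nlinarith
  have hr1 := Phi_lt_one (-(S / 2))
  have hr2 := Phi_pos (-(S / 2))
  refine (G_le_integral_unit hu0 huv hv).trans ?_
  rw [← intervalIntegral.integral_add_adjacent_intervals
    (intervalIntegrable_pairProb u v 0 (Phi (-(S / 2)))) (intervalIntegrable_pairProb u v _ 1)]
  have i1 : ∫ r in (0 : ℝ)..Phi (-(S / 2)), pairProb u v r ≤
      ∫ _r in (0 : ℝ)..Phi (-(S / 2)), Phi (-(√2 * S)) :=
    intervalIntegral.integral_mono_on hr2.le (intervalIntegrable_pairProb _ _ _ _) (by simp)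
      fun r _ => h1 r
  have i2 : ∫ r in Phi (-(S / 2))..1, pairProb u v r ≤
      ∫ _r in Phi (-(S / 2))..1, Phi (-(√2 * S)) * Real.exp (-(min (√β) S / 2)) :=
    intervalIntegral.integral_mono_on_of_le_Ioo hr1.le (intervalIntegrable_pairProb _ _ _ _)
      (by simp) fun r hr => h2 r hr
  simp only [intervalIntegral.integral_const, sub_zero, smul_eq_mul] at i1 i2
  have he := Real.exp_pos (-(min (√β) S / 2))
  have i3 : Phi (-(S / 2)) * Phi (-(√2 * S)) ≤
      Real.exp (-(min (√β) S / 2)) * Phi (-(√2 * S)) := by gcongr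
  have i4 : (1 - Phi (-(S / 2))) * (Phi (-(√2 * S)) * Real.exp (-(min (√β) S / 2))) ≤
      1 * (Phi (-(√2 * S)) * Real.exp (-(min (√β) S / 2))) := by gcongr; linarith
  linarith

/-- This removes `S` from the bound. If `√β ≥ S²`, then `β/S² ≥ √β` and the first factor suffices.
Otherwise `β^(1/4) ≤ S`, so `min √β S ≥ β^(1/4) - 1` and the second factor suffices, at the price of
`exp(1/2) ≤ 2`. -/
lemma exp_mul_exp_min_le {x β S : ℝ} (hx : 0 ≤ x) (hβ : 0 ≤ β) (hS : 0 < S) :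
    Real.exp (-(x * (β / S ^ 2) / 3)) * Real.exp (-(min (√β) S / 2)) ≤
      2 * (Real.exp (-(√(√β) / 2)) + Real.exp (-(x * √β / 3))) := by
  have ht0 : 0 ≤ √(√β) := Real.sqrt_nonneg _
  have ht : √(√β) ^ 2 = √β := Real.sq_sqrt (Real.sqrt_nonneg _)
  have hb : √β ^ 2 = β := Real.sq_sqrt hβ
  have hm0 : 0 ≤ min (√β) S := le_min (Real.sqrt_nonneg _) hS.le
  have e1 := Real.exp_pos (-(√(√β) / 2))
  have e2 := Real.exp_pos (-(x * √β / 3))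
  have hy : 0 ≤ β / S ^ 2 := by positivity
  rcases le_or_gt (S ^ 2) (√β) with h | h
  · have h1 : √β ≤ β / S ^ 2 := by
      rw [le_div_iff₀ (by positivity)]
      calc √β * S ^ 2 ≤ √β * √β := by gcongr
        _ = β := by rw [← sq, hb]
    have h2 : Real.exp (-(x * (β / S ^ 2) / 3)) ≤ Real.exp (-(x * √β / 3)) := by gcongr
    have h3 : Real.exp (-(min (√β) S / 2)) ≤ 1 := Real.exp_le_one_iff.2 (by linarith)
    nlinarith [Real.exp_pos (-(x * (β / S ^ 2) / 3))]
  · have h1 : √(√β) ≤ S := by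
      rw [← ht] at h
      exact (lt_of_pow_lt_pow_left₀ 2 hS.le h).le
    have h2 : √(√β) - 1 ≤ min (√β) S := by
      refine le_min ?_ (by linarith)
      nlinarith [sq_nonneg (√(√β) - 1)]
    have h3 : Real.exp (-(min (√β) S / 2)) ≤ 2 * Real.exp (-(√(√β) / 2)) := by
      have h4 : Real.exp (1 / 2) ≤ 2 := by
        have h6 : Real.exp (1 / 2) ^ 2 = Real.exp 1 := by rw [← Real.exp_nat_mul]; norm_num
        have h5 : Real.exp (1 / 2) ^ 2 ≤ 2 ^ 2 := by
          rw [h6]; linarith [Real.exp_one_lt_d9]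
        exact le_of_sq_le_sq h5 (by norm_num)
      calc _ ≤ Real.exp (1 / 2 + -(√(√β) / 2)) := Real.exp_le_exp.2 (by linarith)
        _ = Real.exp (1 / 2) * Real.exp (-(√(√β) / 2)) := Real.exp_add _ _
        _ ≤ _ := by gcongr
    have h4 : Real.exp (-(x * (β / S ^ 2) / 3)) ≤ 1 :=
      Real.exp_le_one_iff.2 (by have := mul_nonneg hx hy; linarith)
    nlinarith [Real.exp_pos (-(min (√β) S / 2))]

/-- The majorant of the layer integrand. -/
noncomputable def layerMajorant (x β : ℝ) : ℝ :=
  256 * (x ^ 3 * Real.exp (-(x / 3))) * (Real.exp (-(√(√β) / 2)) + Real.exp (-(x * √β / 3)))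

/-- The hypothesis `x² ≤ n` gives `log n ≤ 2 log(n/x)`, hence `√(log n) ≤ 4S`; `x/n ≤ Phi(-4)` gives
`S ≥ 4`. Since `n - 2 ≥ n/3`, the power of `1 - v` splits into decay in `x` and decay in `xβ/S²`.
All powers of `n` and `S` in the prefactor then cancel. -/
theorem layerIntegrand_le {n : ℕ} {x β : ℝ} (hn : 3 ≤ n) (hx : 0 < x) (hxn : x ^ 2 ≤ n)
    (hxPhi : x / n ≤ Phi (-4)) (hβ : 0 ≤ β) (hβn : x * (1 + β / s n x ^ 2) / n < 1) :
    0 ≤ layerIntegrand n x β ∧ layerIntegrand n x β ≤ layerMajorant x β := by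
  set S := s n x with hSdef
  have hn0 : (0 : ℝ) < n := by exact_mod_cast (by omega : 0 < n)
  have hn3 : (3 : ℝ) ≤ n := by exact_mod_cast hn
  have hu : x / n ∈ Set.Ioo (0 : ℝ) 1 := ⟨by positivity, hxPhi.trans_lt (Phi_lt_one _)⟩
  have hS4 : 4 ≤ S := by
    have : PhiInv (x / n) ≤ -4 := by
      rw [← strictMono_Phi.le_iff_le, Phi_PhiInv hu]; exact hxPhi
    rw [hSdef, s]; linarith
  have hS0 : 0 < S := by linarith
  have huS : Phi (-S) = x / n := by rw [hSdef, s, neg_neg, Phi_PhiInv hu]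
  have hy : 0 ≤ β / S ^ 2 := by positivity
  have hveq : x * (1 + β / S ^ 2) / n = x / n * (1 + β / S ^ 2) := by ring
  set v := x * (1 + β / S ^ 2) / n with hvdef
  have hv0 : 0 ≤ v := by positivity
  have hG := G_le_exp hu rfl hS4 hβ (by rw [show -PhiInv (x / n) = S from rfl, ← hveq]; exact hβn)
  rw [show -PhiInv (x / n) = S from rfl, ← hveq] at hG
  have hG0 : 0 ≤ G (x / n) v := G_nonneg hβn
  have hPhi := Phi_sqrt_two_le (s := S) (by linarith)
  rw [huS] at hPhi
  have hpow : (1 - v) ^ (n - 2) ≤ Real.exp (-(x / 3)) * Real.exp (-(x * (β / S ^ 2) / 3)) := by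
    have hc : (n : ℝ) / 3 ≤ ((n - 2 : ℕ) : ℝ) := by
      push_cast [(by omega : 2 ≤ n)]; linarith
    calc (1 - v) ^ (n - 2) ≤ Real.exp (-v) ^ (n - 2) := by
          gcongr; exact Real.one_sub_le_exp_neg _
      _ = Real.exp (-(((n - 2 : ℕ) : ℝ) * v)) := by rw [← Real.exp_nat_mul]; ring_nf
      _ ≤ Real.exp (-((n : ℝ) / 3 * v)) := by gcongr
      _ = _ := by
        rw [← Real.exp_add, hvdef]; congr 1; field_simp; ring
  have hlog : √(Real.log n) ≤ 4 * S := by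
    have h1 := log_inv_Phi_neg_le (s := S) (by linarith)
    rw [huS] at h1
    have h2 : Real.log n ≤ 2 * Real.log (1 / (x / n)) := by
      have : Real.log ((x : ℝ) ^ 2) ≤ Real.log n := Real.log_le_log (by positivity) hxn
      rw [Real.log_pow] at this
      rw [one_div, Real.log_inv, Real.log_div hx.ne' hn0.ne']
      push_cast at this
      linarith
    rw [Real.sqrt_le_left (by positivity)]
    nlinarith
  have hcoef0 : 0 ≤ ((n : ℝ) - 1) * (n - 2) / n :=
    div_nonneg (mul_nonneg (by linarith) (by linarith)) hn0.le
  have hcoef : ((n : ℝ) - 1) * (n - 2) / n ≤ n := by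
    rw [div_le_iff₀ hn0]; nlinarith
  have hpow0 : 0 ≤ (1 - v) ^ (n - 2) := pow_nonneg (by linarith) _
  have hdef : layerIntegrand n x β = n * √(Real.log n) * ((n - 1) * (n - 2) / n) *
      (1 - v) ^ (n - 2) * G (x / n) v * (x / S ^ 2) := rfl
  rw [hdef]
  refine ⟨by positivity, ?_⟩
  have hP0 := Phi_pos (-(√2 * S))
  calc _ ≤ n * (4 * S) * n * (Real.exp (-(x / 3)) * Real.exp (-(x * (β / S ^ 2) / 3))) *
        (2 * (8 * S * (x / n) ^ 2) * Real.exp (-(min (√β) S / 2))) * (x / S ^ 2) := by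
        gcongr
        exact hG.trans (by gcongr)
    _ = 64 * (x ^ 3 * Real.exp (-(x / 3))) * (Real.exp (-(x * (β / S ^ 2) / 3)) *
        Real.exp (-(min (√β) S / 2))) := by field_simp; ring
    _ ≤ 128 * (x ^ 3 * Real.exp (-(x / 3))) *
        (2 * (Real.exp (-(√(√β) / 2)) + Real.exp (-(x * √β / 3)))) := by
        have := exp_mul_exp_min_le hx.le hβ hS0
        gcongr
        norm_num
    _ = _ := by unfold layerMajorant; ring

end Domination

/-! ### Change of variables from `(u, v)` to `(x, β)`. -/

/-- The inner integral of the expectation of `G`. -/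
noncomputable def innerG (n : ℕ) (u : ℝ) : ℝ := ∫ v in u..1, (1 - v) ^ (n - 2) * G u v

lemma measurable_innerG (n : ℕ) : Measurable (innerG n) := by
  unfold innerG
  refine measurable_intervalIntegral (f := fun u v => (1 - v) ^ (n - 2) * G u v) ?_
    measurable_id measurable_const
  have := measurable_G
  fun_prop

lemma abs_innerG_le {n : ℕ} (hn : 2 ≤ n) {u : ℝ} (hu : u ≤ 1) :
    |innerG n u| ≤ (1 - u) ^ (n - 1) := by
  unfold innerG
  refine (intervalIntegral.norm_integral_le_of_norm_le (μ := volume)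
    (f := fun v => (1 - v) ^ (n - 2) * G u v) (g := fun v => (1 - v) ^ (n - 2)) hu
    (Eventually.of_forall fun v hv => ?_)
    (Continuous.intervalIntegrable (by fun_prop) _ _)).trans ?_
  · have h0 : 0 ≤ (1 - v) ^ (n - 2) := pow_nonneg (by linarith [hv.2]) _
    rw [norm_mul, Real.norm_of_nonneg h0]
    exact mul_le_of_le_one_right h0 (abs_G_le_one u v)
  · rw [integral_one_sub_pow, show n - 2 + 1 = n - 1 by omega]
    have h0 : 0 ≤ (1 - u) ^ (n - 1) := pow_nonneg (by linarith) _
    refine div_le_self h0 ?_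
    have : (0 : ℝ) ≤ ((n - 2 : ℕ) : ℝ) := by positivity
    linarith

/-- The inner integral of the layer integrand, expressed through `innerG`. -/
noncomputable def layerMarginal (n : ℕ) (x : ℝ) : ℝ :=
  n * √(Real.log n) * ((n - 1) * (n - 2)) * innerG n (x / n)

/-- For fixed `x`, `v` is an affine function of `β`, running from `x/n` at `β = 0` to `1` at the
upper limit. -/
lemma integral_layerIntegrand {n : ℕ} {x : ℝ} (hn : 0 < n) (hx : 0 < x) (hs : s n x ≠ 0) :
    ∫ β in (0 : ℝ)..(s n x ^ 2 * (n / x - 1)), layerIntegrand n x β = layerMarginal n x := by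
  have hn0 : (0 : ℝ) < n := by exact_mod_cast hn
  set S := s n x with hS
  have hc : x / (n * S ^ 2) ≠ 0 := by positivity
  have h1 : ∀ β, layerIntegrand n x β = (n * √(Real.log n)) * (((n : ℝ) - 1) * ((n : ℝ) - 2) / n) *
      (x / S ^ 2) * (fun v => (1 - v) ^ (n - 2) * G (x / n) v) (x / n + x / (n * S ^ 2) * β) := by
    intro β
    have : x / n + x / (n * S ^ 2) * β = x * (1 + β / S ^ 2) / n := by field_simp
    simp only [this, layerIntegrand, ← hS]
    ring
  simp only [h1]
  rw [intervalIntegral.integral_const_mul, intervalIntegral.integral_comp_add_mul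
    (fun v => (1 - v) ^ (n - 2) * G (x / n) v) hc,
    layerMarginal, innerG]
  have h2 : x / n + x / (n * S ^ 2) * (S ^ 2 * (n / x - 1)) = 1 := by field_simp; ring
  rw [h2, mul_zero, add_zero, smul_eq_mul]
  field_simp

/-- The substitution divides by `s²`, which vanishes only at the median `x = n Phi(0)`, a null set.
-/
lemma ae_s_ne_zero {n : ℕ} (hn : 0 < n) :
    ∀ᵐ x : ℝ, x ∈ Set.Ioo (0 : ℝ) n → s n x ≠ 0 := by
  have hn0 : (0 : ℝ) < n := by exact_mod_cast hn
  have h : ∀ᵐ x : ℝ, x ≠ n * Phi 0 := by simp [ae_iff]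
  filter_upwards [h] with x hx hxn hs
  apply hx
  have : PhiInv (x / n) = 0 := by simpa [s] using hs
  rw [← this, Phi_PhiInv ⟨div_pos hxn.1 hn0, (div_lt_one hn0).2 hxn.2⟩]
  field_simp

lemma integral_integral_layerIntegrand {n : ℕ} (hn : 0 < n) :
    ∫ x in (0 : ℝ)..n, ∫ β in (0 : ℝ)..(s n x ^ 2 * (n / x - 1)), layerIntegrand n x β =
      ∫ x in (0 : ℝ)..n, layerMarginal n x := by
  have h : ∀ᵐ x : ℝ, x ≠ n := by simp [ae_iff]
  refine intervalIntegral.integral_congr_ae ?_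
  filter_upwards [ae_s_ne_zero hn, h] with x hx hxn hmem
  rw [Set.uIoc_of_le (Nat.cast_nonneg n)] at hmem
  exact integral_layerIntegrand hn hmem.1 (hx ⟨hmem.1, hmem.2.lt_of_ne hxn⟩)

section GOE

variable {Ω : Type*} [MeasurableSpace Ω] {μ : Measure Ω} [IsProbabilityMeasure μ] {m : ℕ}
  {Q : Ω → Matrix (Fin (m + 2)) (Fin (m + 2)) ℝ}

lemma IsGOE.I_eq (hQ : IsGOE μ Q) :
    ((m + 2 : ℕ) : ℝ) * √(Real.log (m + 2 : ℕ)) * I μ Q =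
      ∫ x in (0 : ℝ)..((m + 2 : ℕ) : ℝ), layerMarginal (m + 2) x := by
  have hn0 : ((m + 2 : ℕ) : ℝ) ≠ 0 := by positivity
  rw [I, hQ.integral_U measurable_G abs_G_le_one]
  simp only [layerMarginal, intervalIntegral.integral_const_mul]
  rw [intervalIntegral.integral_comp_div (innerG (m + 2)) hn0, zero_div, div_self hn0]
  simp only [innerG, Nat.add_sub_cancel, smul_eq_mul]
  push_cast
  ring

end GOE

/-! ### Dominated convergence in `β`, then in `x`. -/

lemma integral_exp_neg_mul_sqrt {b : ℝ} (hb : 0 < b) :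
    ∫ β in Set.Ioi (0 : ℝ), Real.exp (-(b * √β)) = 2 / b ^ 2 := by
  have h := integral_exp_neg_mul_rpow (p := 1 / 2) (by norm_num) hb
  simp only [← Real.sqrt_eq_rpow] at h
  simp only [neg_mul] at h
  rw [h, show (1 : ℝ) / (1 / 2) + 1 = ((2 : ℕ) : ℝ) + 1 by norm_num, Real.Gamma_nat_eq_factorial,
    show (-1 : ℝ) / (1 / 2) = -((2 : ℕ) : ℝ) by norm_num, Real.rpow_neg hb.le, Real.rpow_natCast]
  simp [Nat.factorial]
  ring

lemma integrableOn_exp_neg_mul_sqrt {b : ℝ} (hb : 0 < b) :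
    IntegrableOn (fun β : ℝ => Real.exp (-(b * √β))) (Set.Ioi 0) := by
  refine Integrable.of_integral_ne_zero ?_
  rw [integral_exp_neg_mul_sqrt hb]
  positivity

lemma integrableOn_exp_neg_sqrt_sqrt :
    IntegrableOn (fun β : ℝ => Real.exp (-(√(√β) / 2))) (Set.Ioi 0) := by
  refine Integrable.of_integral_ne_zero ?_
  have h := integral_exp_neg_mul_rpow (p := 1 / 4) (b := 1 / 2) (by norm_num) (by norm_num)
  have h1 : ∫ β in Set.Ioi (0 : ℝ), Real.exp (-(√(√β) / 2)) =
      ∫ β in Set.Ioi (0 : ℝ), Real.exp (-(1 / 2) * β ^ (1 / 4 : ℝ)) := by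
    refine setIntegral_congr_fun measurableSet_Ioi fun β hβ => ?_
    rw [Real.sqrt_eq_rpow, Real.sqrt_eq_rpow, ← Real.rpow_mul (le_of_lt hβ)]
    norm_num
    ring
  rw [h1, h]
  have := Real.Gamma_pos_of_pos (s := 1 / (1 / 4) + 1) (by norm_num)
  positivity

lemma integrableOn_layerMajorant {x : ℝ} (hx : 0 < x) :
    IntegrableOn (layerMajorant x) (Set.Ioi 0) := by
  have h := integrableOn_exp_neg_mul_sqrt (b := x / 3) (by positivity)
  have := (integrableOn_exp_neg_sqrt_sqrt.add h).const_mul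
    (256 * (x ^ 3 * Real.exp (-(x / 3))))
  refine this.congr (Eventually.of_forall fun β => ?_)
  simp only [Pi.add_apply, layerMajorant]
  ring_nf

lemma integral_layerMajorant {x : ℝ} (hx : 0 < x) :
    ∫ β in Set.Ioi (0 : ℝ), layerMajorant x β = 256 * Real.exp (-(x / 3)) *
      ((∫ β in Set.Ioi (0 : ℝ), Real.exp (-(√(√β) / 2))) * x ^ 3 + 18 * x) := by
  have h := integrableOn_exp_neg_mul_sqrt (b := x / 3) (by positivity)
  have h2 := integral_exp_neg_mul_sqrt (b := x / 3) (by positivity)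
  have h3 : ∀ β, x * √β / 3 = x / 3 * √β := fun β => by ring
  simp only [layerMajorant, h3]
  rw [integral_const_mul, integral_add integrableOn_exp_neg_sqrt_sqrt h, h2]
  field_simp
  ring

lemma layerIntegrand_bound_of_lt {n : ℕ} {x β : ℝ} (hn : 3 ≤ n) (hx : 0 < x) (hxn : x ^ 2 ≤ n)
    (hxPhi : x / n ≤ Phi (-4)) (hβ : 0 ≤ β) (hβn : β < s n x ^ 2 * (n / x - 1)) :
    0 ≤ layerIntegrand n x β ∧ layerIntegrand n x β ≤ layerMajorant x β := by
  have hn0 : (0 : ℝ) < n := by exact_mod_cast (by omega : 0 < n)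
  have hs : 0 < s n x ^ 2 := by
    refine (sq_nonneg _).lt_of_ne fun h => ?_
    rw [← h, zero_mul] at hβn
    linarith
  refine layerIntegrand_le hn hx hxn hxPhi hβ ?_
  rw [div_lt_one hn0]
  have : β / s n x ^ 2 < n / x - 1 := by rwa [div_lt_iff₀ hs, mul_comm]
  calc x * (1 + β / s n x ^ 2) < x * (1 + (n / x - 1)) := by gcongr
    _ = n := by field_simp; ring

lemma s_pos_of_le {n : ℕ} {x : ℝ} (hn : 0 < n) (hx : 0 < x) (hxPhi : x / n ≤ Phi (-4)) :
    0 < s n x := by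
  have hn0 : (0 : ℝ) < n := by exact_mod_cast hn
  have : PhiInv (x / n) ≤ -4 := by
    rw [← strictMono_Phi.le_iff_le, Phi_PhiInv ⟨by positivity, hxPhi.trans_lt (Phi_lt_one _)⟩]
    exact hxPhi
  rw [s]; linarith

lemma measurable_layerIntegrand (n : ℕ) (x : ℝ) : Measurable (layerIntegrand n x) := by
  have := measurable_G_right (x / n)
  unfold layerIntegrand
  fun_prop

/-- The indicator moves the `n`-dependent range of `β` into the integrand, so that dominated
convergence applies on a fixed half-line. -/
lemma layerMarginal_eq_setIntegral {n : ℕ} {x : ℝ} (hn : 3 ≤ n) (hx : 0 < x) (hxn : x ≤ n)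
    (hxPhi : x / n ≤ Phi (-4)) :
    layerMarginal n x = ∫ β in Set.Ioi (0 : ℝ),
      (Set.Iio (s n x ^ 2 * (n / x - 1))).indicator (layerIntegrand n x) β := by
  have hs := s_pos_of_le (by omega) hx hxPhi
  have h0 : 0 ≤ s n x ^ 2 * (n / x - 1) :=
    mul_nonneg (sq_nonneg _) (by rw [sub_nonneg, one_le_div hx]; exact hxn)
  rw [← integral_layerIntegrand (by omega) hx hs.ne', intervalIntegral.integral_of_le h0,
    integral_Ioc_eq_integral_Ioo, setIntegral_indicator measurableSet_Iio]
  rfl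

lemma norm_indicator_layerIntegrand_le {n : ℕ} {x β : ℝ} (hn : 3 ≤ n) (hx : 0 < x)
    (hxn : x ^ 2 ≤ n) (hxPhi : x / n ≤ Phi (-4)) (hβ : 0 < β) :
    ‖(Set.Iio (s n x ^ 2 * (n / x - 1))).indicator (layerIntegrand n x) β‖ ≤
      layerMajorant x β := by
  by_cases hmem : β ∈ Set.Iio (s n x ^ 2 * (n / x - 1))
  · have := layerIntegrand_bound_of_lt hn hx hxn hxPhi hβ.le hmem
    rw [Set.indicator_of_mem hmem, Real.norm_of_nonneg this.1]
    exact this.2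
  · rw [Set.indicator_of_notMem hmem, norm_zero]
    unfold layerMajorant
    positivity

lemma tendsto_s {x : ℝ} (hx : 0 < x) : Tendsto (fun n => s n x) atTop atTop := by
  have h1 : Tendsto (fun n : ℕ => x / n) atTop (𝓝[>] 0) := by
    rw [tendsto_nhdsWithin_iff]
    refine ⟨tendsto_const_div_atTop_nhds_zero_nat x, ?_⟩
    filter_upwards [eventually_gt_atTop 0] with n hn
    have : (0 : ℝ) < n := by exact_mod_cast hn
    exact div_pos hx this
  exact tendsto_neg_atBot_atTop.comp (tendsto_PhiInv_zero.comp h1)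

/-- Dominated convergence in `β` for fixed `x`; the upper limit of integration tends to infinity,
and `1/2` is `∫ exp(-2√β) dβ`. -/
lemma tendsto_layerMarginal {x : ℝ} (hx : 0 < x) :
    Tendsto (fun n => layerMarginal n x) atTop
      (𝓝 (√(Real.pi / 2) * x ^ 3 * Real.exp (-x) * (1 / 2))) := by
  have hn : Tendsto (fun n : ℕ => (n : ℝ)) atTop atTop := tendsto_natCast_atTop_atTop
  have hsmall : ∀ᶠ n : ℕ in atTop, x / n ≤ Phi (-4) :=
    (tendsto_const_div_atTop_nhds_zero_nat x).eventually (ge_mem_nhds (Phi_pos _))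
  have hup : Tendsto (fun n : ℕ => s n x ^ 2 * (n / x - 1)) atTop atTop :=
    ((tendsto_pow_atTop two_ne_zero).comp (tendsto_s hx)).atTop_mul_atTop₀
      (tendsto_atTop_add_const_right _ _ (hn.atTop_div_const hx))
  have h := tendsto_integral_filter_of_dominated_convergence
    (μ := volume.restrict (Set.Ioi (0 : ℝ))) (l := atTop)
    (F := fun (n : ℕ) β => (Set.Iio (s n x ^ 2 * (n / x - 1))).indicator (layerIntegrand n x) β)
    (f := fun β => √(Real.pi / 2) * x ^ 3 * Real.exp (-x) * Real.exp (-(2 * √β)))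
    (layerMajorant x)
    (Eventually.of_forall fun n =>
      ((measurable_layerIntegrand n x).indicator measurableSet_Iio).aestronglyMeasurable) ?_
    (integrableOn_layerMajorant hx) ?_
  · rw [integral_const_mul, integral_exp_neg_mul_sqrt two_pos,
      show (2 : ℝ) / 2 ^ 2 = 1 / 2 by norm_num] at h
    refine h.congr' ?_
    filter_upwards [hsmall, eventually_ge_atTop 3, hn.eventually_ge_atTop x] with n h1 h2 h3
    exact (layerMarginal_eq_setIntegral h2 hx h3 h1).symm
  · filter_upwards [hsmall, eventually_ge_atTop 3, hn.eventually_ge_atTop (x ^ 2)] with n h1 h2 h3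
    filter_upwards [ae_restrict_mem measurableSet_Ioi] with β hβ
    exact norm_indicator_layerIntegrand_le h2 hx h3 h1 hβ
  · filter_upwards [ae_restrict_mem measurableSet_Ioi] with β hβ
    have h1 := tendsto_layerIntegrand (N := fun n : ℕ => n) (x := fun _ => x) (β := fun _ => β)
      tendsto_id tendsto_const_nhds hx tendsto_const_nhds
      (Eventually.of_forall fun _ => le_of_lt hβ)
    rw [neg_mul] at h1
    refine h1.congr' ?_
    filter_upwards [hup.eventually_gt_atTop β] with n hn
    exact (Set.indicator_of_mem (Set.mem_Iio.2 hn) _).symm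

/-- The majorant of the marginal. -/
noncomputable def marginalMajorant (x : ℝ) : ℝ :=
  256 * Real.exp (-(x / 3)) *
    ((∫ β in Set.Ioi (0 : ℝ), Real.exp (-(√(√β) / 2))) * x ^ 3 + 18 * x) +
    x ^ 8 * Real.exp (-(x / 2))

lemma integrableOn_pow_mul_exp_neg (k : ℕ) {b : ℝ} (hb : 0 < b) :
    IntegrableOn (fun x : ℝ => x ^ k * Real.exp (-(b * x))) (Set.Ioi 0) := by
  have h := integrableOn_rpow_mul_exp_neg_mul_rpow (p := 1) (s := k) (b := b)
    (by have : (0 : ℝ) ≤ k := by positivity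
        linarith) one_pos hb
  refine h.congr (Eventually.of_forall fun x => ?_)
  simp

lemma integrableOn_marginalMajorant : IntegrableOn marginalMajorant (Set.Ioi 0) := by
  have h3 := integrableOn_pow_mul_exp_neg 3 (b := 1 / 3) (by norm_num)
  have h1 := integrableOn_pow_mul_exp_neg 1 (b := 1 / 3) (by norm_num)
  have h8 := integrableOn_pow_mul_exp_neg 8 (b := 1 / 2) (by norm_num)
  have := ((h3.const_mul (256 * ∫ β in Set.Ioi (0 : ℝ), Real.exp (-(√(√β) / 2)))).add
    (h1.const_mul (256 * 18))).add h8
  refine this.congr (Eventually.of_forall fun x => ?_)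
  simp only [Pi.add_apply, marginalMajorant]
  ring_nf

/-- If `x² ≤ n`, then `1 ≤ n Phi(-4)²` ensures `x/n ≤ Phi(-4)` and the layer majorant can be
integrated. If `x² > n`, the bound `|G| ≤ 1` leaves a prefactor of at most `n⁴ ≤ x⁸` times `(1 -
x/n)^(n-1) ≤ exp(-x/2)`. -/
lemma abs_layerMarginal_le {n : ℕ} {x : ℝ} (hn : 3 ≤ n) (hnPhi : 1 ≤ n * Phi (-4) ^ 2)
    (hx : 0 < x) (hxn : x < n) : |layerMarginal n x| ≤ marginalMajorant x := by
  have hn0 : (0 : ℝ) < n := by exact_mod_cast (by omega : 0 < n)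
  have hn3 : (3 : ℝ) ≤ n := by exact_mod_cast hn
  have hP := Phi_pos (-4)
  have hc0 : 0 ≤ ∫ β in Set.Ioi (0 : ℝ), Real.exp (-(√(√β) / 2)) :=
    integral_nonneg fun β => (Real.exp_pos _).le
  rcases le_or_gt (x ^ 2) n with h | h
  · have hxPhi : x / n ≤ Phi (-4) := by
      rw [div_le_iff₀ hn0]
      refine le_of_sq_le_sq ?_ (by positivity)
      calc x ^ 2 ≤ n * 1 := by linarith
        _ ≤ n * (n * Phi (-4) ^ 2) := by gcongr
        _ = _ := by ring
    rw [layerMarginal_eq_setIntegral hn hx hxn.le hxPhi]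
    refine (norm_integral_le_of_norm_le (f := fun β => (Set.Iio (s n x ^ 2 * (n / x - 1))).indicator
      (layerIntegrand n x) β) (integrableOn_layerMajorant hx) ?_).trans ?_
    · filter_upwards [ae_restrict_mem measurableSet_Ioi] with β hβ
      exact norm_indicator_layerIntegrand_le hn hx h hxPhi hβ
    · rw [integral_layerMajorant hx, marginalMajorant]
      have : 0 ≤ x ^ 8 * Real.exp (-(x / 2)) := by positivity
      linarith
  · have h1 := abs_innerG_le (n := n) (by omega) (u := x / n) ((div_le_one hn0).2 hxn.le)
    have h2 : (1 - x / n) ^ (n - 1) ≤ Real.exp (-(x / 2)) := by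
      have h3 : 0 ≤ 1 - x / n := by rw [sub_nonneg, div_le_one hn0]; exact hxn.le
      calc (1 - x / n) ^ (n - 1) ≤ Real.exp (-(x / n)) ^ (n - 1) := by
            gcongr; exact Real.one_sub_le_exp_neg _
        _ = Real.exp (-(((n - 1 : ℕ) : ℝ) * (x / n))) := by rw [← Real.exp_nat_mul]; ring_nf
        _ ≤ Real.exp (-((n : ℝ) / 2 * (x / n))) := by
          have : (n : ℝ) / 2 ≤ ((n - 1 : ℕ) : ℝ) := by
            push_cast [(by omega : 1 ≤ n)]; linarith
          gcongr
        _ = _ := by congr 1; field_simp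
    have h4 : √(Real.log n) ≤ n := by
      rw [Real.sqrt_le_left hn0.le]
      have := Real.log_le_sub_one_of_pos hn0
      nlinarith
    have hcoef0 : 0 ≤ ((n : ℝ) - 1) * (n - 2) := mul_nonneg (by linarith) (by linarith)
    have hcoef : ((n : ℝ) - 1) * (n - 2) ≤ n ^ 2 := by nlinarith
    have h5 : |layerMarginal n x| ≤ x ^ 8 * Real.exp (-(x / 2)) := by
      unfold layerMarginal
      rw [abs_mul, abs_of_nonneg (by positivity)]
      calc _ ≤ n * n * n ^ 2 * Real.exp (-(x / 2)) := by
            gcongr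
            exact h1.trans h2
        _ = (n : ℝ) ^ 4 * Real.exp (-(x / 2)) := by ring
        _ ≤ (x ^ 2) ^ 4 * Real.exp (-(x / 2)) := by gcongr
        _ = _ := by ring
    refine h5.trans ?_
    unfold marginalMajorant
    have : 0 ≤ 256 * Real.exp (-(x / 3)) *
      ((∫ β in Set.Ioi (0 : ℝ), Real.exp (-(√(√β) / 2))) * x ^ 3 + 18 * x) := by positivity
    linarith

lemma measurable_layerMarginal (n : ℕ) : Measurable (layerMarginal n) := by
  have := measurable_innerG n
  unfold layerMarginal
  fun_prop

theorem tendsto_integral_layerMarginal :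
    Tendsto (fun n : ℕ => ∫ x in (0 : ℝ)..n, layerMarginal n x) atTop
      (𝓝 (3 * √(Real.pi / 2))) := by
  have h := tendsto_integral_filter_of_dominated_convergence
    (μ := volume.restrict (Set.Ioi (0 : ℝ))) (l := atTop)
    (F := fun (n : ℕ) x => (Set.Iio (n : ℝ)).indicator (layerMarginal n) x)
    (f := fun x => √(Real.pi / 2) * x ^ 3 * Real.exp (-x) * (1 / 2))
    marginalMajorant
    (Eventually.of_forall fun n =>
      ((measurable_layerMarginal n).indicator measurableSet_Iio).aestronglyMeasurable) ?_
    integrableOn_marginalMajorant ?_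
  · have hval : ∫ x in Set.Ioi (0 : ℝ), √(Real.pi / 2) * x ^ 3 * Real.exp (-x) * (1 / 2) =
        3 * √(Real.pi / 2) := by
      have hG := Real.integral_rpow_mul_exp_neg_mul_Ioi (a := 4) (r := 1) (by norm_num) one_pos
      rw [show (4 : ℝ) = ((3 : ℕ) : ℝ) + 1 by norm_num, Real.Gamma_nat_eq_factorial,
        add_sub_cancel_right] at hG
      simp only [Real.rpow_natCast, one_mul, div_one, Real.one_rpow] at hG
      have : ∀ x : ℝ, √(Real.pi / 2) * x ^ 3 * Real.exp (-x) * (1 / 2) =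
          √(Real.pi / 2) / 2 * (x ^ 3 * Real.exp (-x)) := fun x => by ring
      simp only [this]
      rw [integral_const_mul, hG]
      simp [Nat.factorial]
      ring
    rw [hval] at h
    refine h.congr fun n => ?_
    rw [intervalIntegral.integral_of_le (Nat.cast_nonneg n), integral_Ioc_eq_integral_Ioo,
      setIntegral_indicator measurableSet_Iio]
    rfl
  · have hev : ∀ᶠ n : ℕ in atTop, 1 ≤ n * Phi (-4) ^ 2 :=
      (tendsto_natCast_atTop_atTop.atTop_mul_const
        (pow_pos (Phi_pos (-4)) 2)).eventually_ge_atTop 1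
    filter_upwards [hev, eventually_ge_atTop 3] with n h1 h2
    filter_upwards [ae_restrict_mem measurableSet_Ioi] with x hx
    have hx0 : (0 : ℝ) < x := hx
    by_cases hxn : x < n
    · rw [Set.indicator_of_mem (Set.mem_Iio.2 hxn)]
      exact abs_layerMarginal_le h2 h1 hx hxn
    · rw [Set.indicator_of_notMem (by simpa using hxn), norm_zero]
      have hc0 : 0 ≤ ∫ β in Set.Ioi (0 : ℝ), Real.exp (-(√(√β) / 2)) :=
        integral_nonneg fun β => (Real.exp_pos _).le
      unfold marginalMajorant
      positivity
  · filter_upwards [ae_restrict_mem measurableSet_Ioi] with x hx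
    refine (tendsto_layerMarginal hx).congr' ?_
    filter_upwards [tendsto_natCast_atTop_atTop.eventually_gt_atTop x] with n hn
    exact (Set.indicator_of_mem (Set.mem_Iio.2 hn) _).symm

/-! ### The asymptotics of `I_n` and `A_n`. -/

section GOE

variable {Ω : ℕ → Type*} [∀ n, MeasurableSpace (Ω n)] {μ : ∀ n, Measure (Ω n)}
  [∀ n, IsProbabilityMeasure (μ n)] {Q : ∀ n, Ω n → Matrix (Fin n) (Fin n) ℝ}

lemma mul_I_eq_integral_layerMarginal (hQ : ∀ n, IsGOE (μ n) (Q n)) {n : ℕ} (hn : 2 ≤ n) :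
    n * √(Real.log n) * I (μ n) (Q n) = ∫ x in (0 : ℝ)..n, layerMarginal n x := by
  obtain ⟨m, rfl⟩ := Nat.exists_eq_add_of_le' hn
  exact (hQ (m + 2)).I_eq

lemma tendsto_I (hQ : ∀ n, IsGOE (μ n) (Q n)) :
    Tendsto (fun n : ℕ => I (μ n) (Q n) * (n * √(Real.log n))) atTop
      (𝓝 (3 * √(Real.pi / 2))) := by
  refine tendsto_integral_layerMarginal.congr' ?_
  filter_upwards [eventually_ge_atTop 2] with n hn
  rw [← mul_I_eq_integral_layerMarginal hQ hn, mul_comm]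

lemma A_sub_I_isBigO (hQ : ∀ n, IsGOE (μ n) (Q n)) :
    (fun n : ℕ => A (μ n) (Q n) - I (μ n) (Q n)) =O[atTop]
      fun n : ℕ => Real.log n / (n : ℝ) ^ 2 := by
  refine IsBigO.of_bound (2 * ((128 + 1 / Phi (-1) ^ 4) * 864)) ?_
  filter_upwards [eventually_ge_atTop 3] with n hn
  obtain ⟨m, rfl⟩ := Nat.exists_eq_add_of_le' (by omega : 2 ≤ n)
  have hlog := one_le_log_of_three_le hn
  rw [Real.norm_of_nonneg (r := Real.log _ / _) (by positivity)]
  exact (hQ (m + 2)).abs_A_sub_I_le (by omega)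

/-- The reduction error is negligible at the scale `1/(n√(log n))`: the quotient is `(log
n)^(3/2)/n`, bounded by `(log n)²/n` once `log n ≥ 1`. -/
lemma tendsto_log_div_sq_mul :
    Tendsto (fun n : ℕ => Real.log n / (n : ℝ) ^ 2 * (n * √(Real.log n))) atTop (𝓝 0) := by
  have h1 : Tendsto (fun x : ℝ => Real.log x ^ 2 / (1 * x + 0)) atTop (𝓝 0) :=
    Real.tendsto_pow_log_div_mul_add_atTop 1 0 2 one_ne_zero
  have h2 := h1.comp tendsto_natCast_atTop_atTop (α := ℕ)
  refine squeeze_zero' (Eventually.of_forall fun n => ?_) ?_ h2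
  · have := Real.log_natCast_nonneg n
    positivity
  · filter_upwards [eventually_ge_atTop 3] with n hn
    have hlog := one_le_log_of_three_le hn
    have hn0 : (0 : ℝ) < n := by exact_mod_cast (by omega : 0 < n)
    have hs : √(Real.log n) ≤ Real.log n := by
      rw [Real.sqrt_le_left (by linarith)]; nlinarith
    simp only [Function.comp_apply, one_mul, add_zero]
    calc Real.log n / (n : ℝ) ^ 2 * (n * √(Real.log n)) ≤
        Real.log n / (n : ℝ) ^ 2 * (n * Real.log n) := by gcongr
      _ = _ := by field_simp

lemma tendsto_A (hQ : ∀ n, IsGOE (μ n) (Q n)) :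
    Tendsto (fun n : ℕ => A (μ n) (Q n) * (n * √(Real.log n))) atTop
      (𝓝 (3 * √(Real.pi / 2))) := by
  have h1 : Tendsto (fun n : ℕ => (A (μ n) (Q n) - I (μ n) (Q n)) * (n * √(Real.log n))) atTop
      (𝓝 0) :=
    ((A_sub_I_isBigO hQ).mul (isBigO_refl (fun n : ℕ => n * √(Real.log n)) atTop)).trans_tendsto
      tendsto_log_div_sq_mul
  have h2 := h1.add (tendsto_I hQ)
  rw [zero_add] at h2
  refine h2.congr fun n => ?_
  ring

end GOE

end GOE

theorem mainTheorem4 {Ω : ℕ → Type*} [∀ n, MeasurableSpace (Ω n)]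
    (μ : ∀ n, Measure (Ω n)) [∀ n, IsProbabilityMeasure (μ n)]
    (Q : ∀ n, Ω n → Matrix (Fin n) (Fin n) ℝ) (hQ : ∀ n, GOE.IsGOE (μ n) (Q n)) :
    -- the asymptotics of `A_n`
    Tendsto (fun n : ℕ => GOE.A (μ n) (Q n) * (n * √(Real.log n))) atTop
      (𝓝 (3 * √(Real.pi / 2))) ∧
    -- the conditional pair probabilities
    (∀ n i j : ℕ, 1 ≤ i → i < j → j ≤ n →
      GOE.p (μ n) (Q n) i j =ᵐ[μ n] fun ω => GOE.Phi (√2 * GOE.tau (Q n ω) i j)) ∧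
    -- the reduction of `A_n` to `I_n = (n-2) E G(U_(1), U_(2))`
    ((fun n : ℕ => GOE.A (μ n) (Q n) - GOE.I (μ n) (Q n)) =O[atTop]
      fun n : ℕ => Real.log n / (n : ℝ) ^ 2) ∧
    -- `I_n` in the boundary-layer variables
    (∀ n : ℕ, 3 ≤ n → n * √(Real.log n) * GOE.I (μ n) (Q n) =
      ∫ x in (0 : ℝ)..n, ∫ β in (0 : ℝ)..(GOE.s n x ^ 2 * (n / x - 1)),
        GOE.layerIntegrand n x β) ∧
    -- the limit of the integrand, uniformly on compact rectangles
    (∀ δ M B : ℝ, 0 < δ →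
      TendstoUniformlyOn (fun (n : ℕ) (z : ℝ × ℝ) => GOE.layerIntegrand n z.1 z.2)
        (fun z => √(Real.pi / 2) * z.1 ^ 3 * Real.exp (-z.1) * Real.exp (-2 * √z.2))
        atTop (Set.Icc δ M ×ˢ Set.Icc 0 B)) ∧
    -- the asymptotics of `I_n`
    Tendsto (fun n : ℕ => GOE.I (μ n) (Q n) * (n * √(Real.log n))) atTop
      (𝓝 (3 * √(Real.pi / 2))) := by
  refine ⟨GOE.tendsto_A hQ, fun n i j hi hij hj => (hQ n).p_ae_eq hi hij hj,
    GOE.A_sub_I_isBigO hQ, fun n hn => ?_,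
    fun δ M B hδ => GOE.tendstoUniformlyOn_layerIntegrand M B hδ, GOE.tendsto_I hQ⟩
  rw [GOE.integral_integral_layerIntegrand (by omega)]
  exact GOE.mul_I_eq_integral_layerMarginal hQ (by omega)
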